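/- **Setting.** Let $2\le n_t\le n_r$, let $\omega:\mathbb R\to\mathbb R$ (only its values on $(0,\infty)$ matter) and write $\mathcal M\omega(s)=\int_0^\infty x^{s-1}\omega(x)\,dx$. Assume that $\omega$ is $n_t-2$ times continuously differentiable on $(0,\infty)$ with locally absolutely continuous derivative $\omega^{(n_t-2)}$ there, that $\int_0^\infty \lambda^a\,|\partial_\lambda^b[\lambda^b\omega(\lambda)]|\,d\lambda<\infty$ for $0\le a,b\le n_t-1$, and that $\mathcal M\omega(l+1)\ne0$ for $0\le l\le n_t-1$. Put $$p_l(\lambda)=\sum_{j=0}^l\frac{(-1)^{l-j}\,l!\,\mathcal M\omega(l+1)}{j!\,(l-j)!\,\mathcal M\omega(j+1)}\lambda^j,\qquad q_l(\lambda)=\frac{1}{l!\,\mathcal M\omega(l+1)}\,\partial_\lambda^l[(-\lambda)^l\omega(\lambda)],\qquad K(x,y)=\sum_{j=0}^{n_t-1}p_j(x)q_j(y).$$ Let $\mathbf P$ be a random complex $n_r\times n_t$ matrix which is a Pólya ensemble with weight $\omega$: $\mathbf P^\dagger\mathbf P$ is distributed as $\mathbf U^\dagger\boldsymbol\Lambda\mathbf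 U$, where $\mathbf U\in\mathcal U(n_t)$ is Haar distributed and, independently of $\mathbf U$, $\boldsymbol\Lambda=\mathrm{diag}(\lambda_1,\dots,\lambda_{n_t})>0$ has the (nonnegative) joint density $\frac1{n_t!}\prod_{k>\ell}(\lambda_k-\lambda_\ell)\,\det[q_{b-1}(\lambda_a)]_{a,b=1,\dots,n_t}$. Let $\boldsymbol\Sigma_t$ be a deterministic positive definite Hermitian $n_t\times n_t$ matrix, $\sigma_k=(\boldsymbol\Sigma_t^{-1})_{kk}$, $\mathbf H=\mathbf P\sqrt{\boldsymbol\Sigma_t}$, and $\delta>0$. The zero-forcing SINR of the $k$-th stream is $\gamma_k=\delta/[(\mathbf H^\dagger\mathbf H)^{-1}]_{kk}$, and the sum rate is $R=\sum_{k=1}^{n_t}\mathbb E[\ln(1+\gamma_k)]$. Finally, for $x>0$ and any $r\in(0,1)$, let $$G^{1,2}_{2,2}\left(\left.\begin{array}{c}1,1;-\\1;0\end{array}\right|x\right)=\int_{r-i\infty}^{r+i\infty}\frac{ds}{2\pi i}\,\frac{\Gamma(1-s)\,\Gamma(s)^2}{\Gamma(1+s)}\,x^s .$$ **Claim.** 1.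 The $p_j$ are monic of degree $j$ and $\int_0^\infty p_aq_b\,d\lambda=\delta_{ab}$ for $0\le a,b<n_t$ (so $K$ is the correlation kernel of the ensemble), and $$K(0,y)=\frac{1}{(n_t-1)!\,\mathcal M\omega(1)}\,\frac1y\,\partial_y^{n_t-1}[y^{n_t}\omega(y)]$$ at every $y>0$ at which $\omega^{(n_t-2)}$ is differentiable, hence for almost every $y>0$. 2. For every $k$, $\gamma_k$ has on $(0,\infty)$ the nonnegative probability density $$\rho(\gamma)=\frac{\sigma_k}{\delta\,\mathcal M\omega(1)}\,\omega\!\left(\frac{\sigma_k\gamma}{\delta}\right);$$ for given $\sigma_k$ and $\delta$ this expression does not involve $n_t$. 3. Every $\ln(1+\gamma_k)$ is integrable, the following integral converges absolutely, and $$R=\frac1{\mathcal M\omega(1)}\int_0^\infty \omega(x)\sum_{k=1}^{n_t}G^{1,2}_{2,2}\left(\left.\begin{array}{c}1,1;-\\1;0\end{array}\right|\frac{\delta x}{\sigma_k}\right)dx .$$ 4. If $\boldsymbol\Sigma_t=\mathbf I$, the sum rate is exactly linear in $n_t$ (for given $\omega$ and $\delta$): $$R=n_t\cdot\frac1{\mathcal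 M\omega(1)}\int_0^\infty \omega(x)\,G^{1,2}_{2,2}\left(\left.\begin{array}{c}1,1;-\\1;0\end{array}\right|\delta x\right)dx .$$ -/

import Mathlib

open MeasureTheory Set
open scoped ComplexOrder MatrixOrder Nat Matrix

noncomputable section

namespace ZFMimo

/-! ### Random complex matrices and Haar measure on the unitary group -/

/-- Entrywise (product) measurable structure on complex matrices. -/
instance matrixMeasurableSpace {m n : Type*} : MeasurableSpace (Matrix m n ℂ) :=
  inferInstanceAs (MeasurableSpace (m → n → ℂ))

instance matrixBorelSpace {m n : Type*} [Countable m] [Countable n] :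
    BorelSpace (Matrix m n ℂ) :=
  inferInstanceAs (BorelSpace (m → n → ℂ))

instance unitaryGroupCompactSpace (n : ℕ) :
    CompactSpace (Matrix.unitaryGroup (Fin n) ℂ) := by
  have hclosed : IsClosed ((Matrix.unitaryGroup (Fin n) ℂ : Submonoid _) :
      Set (Matrix (Fin n) (Fin n) ℂ)) := by
    have h : ((Matrix.unitaryGroup (Fin n) ℂ : Submonoid _) :
        Set (Matrix (Fin n) (Fin n) ℂ)) = {A | A * star A = 1} := by
      ext A
      exact Matrix.mem_unitaryGroup_iff
    rw [h]
    exact isClosed_eq (by fun_prop) continuous_const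
  have hK : IsCompact (Set.pi Set.univ
      (fun _ : Fin n => Set.pi Set.univ (fun _ : Fin n => Metric.closedBall (0 : ℂ) 1))) :=
    isCompact_univ_pi fun _ => isCompact_univ_pi fun _ => isCompact_closedBall _ _
  refine isCompact_iff_compactSpace.mp (hK.of_isClosed_subset hclosed ?_)
  intro A hA i _ j _
  simpa using entry_norm_bound_of_unitary hA i j

/-- The Haar probability measure on the unitary group `U(n)`. -/
def haarUnitary (n : ℕ) : Measure (Matrix.unitaryGroup (Fin n) ℂ) :=
  Measure.haarMeasure ⊤

/-! ### Invariant polynomial ensembles -/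

/-- The joint eigenvalue function `(1/n!) Δ(Λ) det[q_{b-1}(λ_a)]` of a polynomial ensemble;
`det (vandermonde Λ) = ∏_{k > l} (λ_k - λ_l)`. -/
def eigenDensity (n : ℕ) (q : ℕ → ℝ → ℝ) (Λ : Fin n → ℝ) : ℝ :=
  (1 / (n ! : ℝ)) * (Matrix.vandermonde Λ).det *
    (Matrix.of fun a b : Fin n => q (b : ℕ) (Λ a)).det

/-- Lebesgue measure on `(0, ∞)^n`. -/
def orthantVolume (n : ℕ) : Measure (Fin n → ℝ) :=
  volume.restrict {Λ | ∀ i, 0 < Λ i}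

/-- The law of `U† diag(Λ) U` with `U` Haar distributed on `U(n)` and, independently of `U`, the
vector `Λ` distributed on `(0, ∞)^n` with density `eigenDensity n q`. -/
def invariantLaw (n : ℕ) (q : ℕ → ℝ → ℝ) : Measure (Matrix (Fin n) (Fin n) ℂ) :=
  ((haarUnitary n).prod
      ((orthantVolume n).withDensity fun Λ => ENNReal.ofReal (eigenDensity n q Λ))).map
    fun x => (x.1 : Matrix (Fin n) (Fin n) ℂ)ᴴ * Matrix.diagonal (fun i => (x.2 i : ℂ)) *
      (x.1 : Matrix (Fin n) (Fin n) ℂ)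

/-- `P` is an invariant polynomial ensemble with weights `q_0, …, q_{n_t - 1}`: the Gram matrix
`P† P` is distributed as `U† Λ U`, with `U` Haar distributed and `Λ` having the joint density
`(1/n_t!) Δ(Λ) det[q_{b-1}(λ_a)]`. -/
structure IsInvariantPolynomialEnsemble {Ω : Type*} [MeasurableSpace Ω] (μ : Measure Ω)
    {nr nt : ℕ} (P : Ω → Matrix (Fin nr) (Fin nt) ℂ) (q : ℕ → ℝ → ℝ) : Prop where
  aemeasurable : AEMeasurable P μ
  density_nonneg : ∀ᵐ Λ ∂(orthantVolume nt), 0 ≤ eigenDensity nt q Λ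
  map_gram : μ.map (fun w => (P w)ᴴ * P w) = invariantLaw nt q

/-- Monic polynomials `p_0, …, p_{n-1}`, `deg p_j = j`, biorthonormal to `q_0, …, q_{n-1}`
on `(0, ∞)`. -/
def IsBiorthonormal (n : ℕ) (p : ℕ → Polynomial ℝ) (q : ℕ → ℝ → ℝ) : Prop :=
  (∀ j < n, (p j).Monic ∧ (p j).natDegree = j) ∧
  ∀ a < n, ∀ b < n, IntegrableOn (fun x => (p a).eval x * q b x) (Ioi 0) ∧
    ∫ x in Ioi (0 : ℝ), (p a).eval x * q b x = if a = b then 1 else 0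

/-- The correlation kernel `K(x, y) = ∑_{j < n} p_j(x) q_j(y)`. -/
def kernel (n : ℕ) (p : ℕ → Polynomial ℝ) (q : ℕ → ℝ → ℝ) (x y : ℝ) : ℝ :=
  ∑ j ∈ Finset.range n, (p j).eval x * q j y

/-! ### Pólya ensembles -/

/-- The Mellin transform `Mω(s) = ∫_0^∞ x^{s-1} ω(x) dx` of a real function at a real point. -/
def mellinAt (ω : ℝ → ℝ) (s : ℝ) : ℝ :=
  ∫ x in Ioi (0 : ℝ), x ^ (s - 1) * ω x

theorem mellinAt_eq_mellin (ω : ℝ → ℝ) (s : ℝ) :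
    (mellinAt ω s : ℂ) = mellin (fun x => (ω x : ℂ)) (s : ℂ) := by
  unfold mellinAt mellin
  rw [← integral_complex_ofReal]
  refine setIntegral_congr_fun measurableSet_Ioi fun x hx => ?_
  have hx' : (0 : ℝ) ≤ x := le_of_lt hx
  simp only [smul_eq_mul, Complex.ofReal_mul, Complex.ofReal_cpow hx', Complex.ofReal_sub,
    Complex.ofReal_one]

/-- `p_l(λ) = ∑_{j ≤ l} (-1)^{l-j} l! Mω(l+1) / (j! (l-j)! Mω(j+1)) λ^j`. -/
def polyaP (ω : ℝ → ℝ) (l : ℕ) : Polynomial ℝ :=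
  ∑ j ∈ Finset.range (l + 1),
    Polynomial.C ((-1) ^ (l - j) * (l ! : ℝ) * mellinAt ω (l + 1) /
      ((j ! : ℝ) * ((l - j)! : ℝ) * mellinAt ω (j + 1))) * Polynomial.X ^ j

/-- `q_l(λ) = 1 / (l! Mω(l+1)) ∂_λ^l [(-λ)^l ω(λ)]`. -/
def polyaQ (ω : ℝ → ℝ) (l : ℕ) (y : ℝ) : ℝ :=
  1 / ((l ! : ℝ) * mellinAt ω (l + 1)) * iteratedDeriv l (fun x => (-x) ^ l * ω x) y

/-- The regularity of the weight that the definition of the functions `q_l` and their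
biorthonormality with polynomials presuppose (for `n ≥ 2`): `ω` is `n - 2` times continuously
differentiable on `(0, ∞)`, its derivative of order `n - 2` is locally absolutely continuous there
(so the derivative of order `n - 1` exists almost everywhere), the moments of orders
`0, …, n - 1` of `∂^b[λ^b ω(λ)]`, `b < n`, are finite, and the Mellin transforms in the
denominators do not vanish. -/
structure IsPolyaWeight (n : ℕ) (ω : ℝ → ℝ) : Prop where
  contDiffOn : ContDiffOn ℝ ((n - 2 : ℕ) : WithTop ℕ∞) ω (Ioi 0)
  locallyAC : ∀ a b : ℝ, 0 < a → a ≤ b →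
    AbsolutelyContinuousOnInterval (iteratedDeriv (n - 2) ω) a b
  integrableOn : ∀ a < n, ∀ b < n,
    IntegrableOn (fun y => y ^ a * iteratedDeriv b (fun x => x ^ b * ω x) y) (Ioi 0)
  mellin_ne_zero : ∀ l < n, mellinAt ω (l + 1) ≠ 0

/-- `P` is a Pólya ensemble with weight `ω`: an invariant polynomial ensemble with the functions
`q_l = polyaQ ω l`. -/
structure IsPolyaEnsemble {Ω : Type*} [MeasurableSpace Ω] (μ : Measure Ω)
    {nr nt : ℕ} (P : Ω → Matrix (Fin nr) (Fin nt) ℂ) (ω : ℝ → ℝ) : Prop where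
  weight : IsPolyaWeight nt ω
  ensemble : IsInvariantPolynomialEnsemble μ P (polyaQ ω)

/-- The correlation kernel of the Pólya ensemble of size `n` with weight `ω`. -/
def polyaKernel (n : ℕ) (ω : ℝ → ℝ) : ℝ → ℝ → ℝ :=
  kernel n (polyaP ω) (polyaQ ω)

/-! ### The zero-forcing receiver -/

/-- The channel matrix `H = P √Σ_t`. -/
def channel {nr nt : ℕ} (P : Matrix (Fin nr) (Fin nt) ℂ) (S : Matrix (Fin nt) (Fin nt) ℂ) :
    Matrix (Fin nr) (Fin nt) ℂ :=
  P * CFC.sqrt S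

/-- `γ_k = δ / [(H† H)⁻¹]_{kk}`; the diagonal entry is real as the matrix is Hermitian. -/
def zfSINR {nr nt : ℕ} (δ : ℝ) (H : Matrix (Fin nr) (Fin nt) ℂ) (k : Fin nt) : ℝ :=
  δ / ((Hᴴ * H)⁻¹ k k).re

/-- `σ_k = (Σ_t⁻¹)_{kk}`, real as `Σ_t` is Hermitian. -/
def invDiag {nt : ℕ} (S : Matrix (Fin nt) (Fin nt) ℂ) (k : Fin nt) : ℝ :=
  (S⁻¹ k k).re

/-- The ergodic sum rate `R = ∑_k E[ln(1 + γ_k)]` of the zero-forcing receiver. -/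
def zfSumRate {Ω : Type*} [MeasurableSpace Ω] (μ : Measure Ω) {nr nt : ℕ} (δ : ℝ)
    (H : Ω → Matrix (Fin nr) (Fin nt) ℂ) : ℝ :=
  ∑ k : Fin nt, ∫ w, Real.log (1 + zfSINR δ (H w) k) ∂μ

/-! ### Meijer G-functions -/

/-- The integrand
`∏Γ(c_j - s) ∏Γ(1 - a_j + s) / (∏Γ(b_j - s) ∏Γ(1 - d_j + s)) x^s`. -/
def meijerIntegrand (a b c d : List ℂ) (x : ℝ) (s : ℂ) : ℂ :=
  ((c.map fun u => Complex.Gamma (u - s)).prod *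
      (a.map fun u => Complex.Gamma (1 - u + s)).prod) /
    ((b.map fun u => Complex.Gamma (u - s)).prod *
      (d.map fun u => Complex.Gamma (1 - u + s)).prod) * (x : ℂ) ^ s

/-- The line `Re s = r` has all poles of the `Γ(c_j - s)` on its right and all poles of the
`Γ(1 - a_j + s)` on its left. -/
def Separates (r : ℝ) (a c : List ℂ) : Prop :=
  (∀ u ∈ a, u.re - 1 < r) ∧ ∀ u ∈ c, r < u.re

/-- The Meijer G-function `G(a; b | c; d | x) = ∫ ds/(2πi) meijerIntegrand a b c d x s`, with
`a = (a_1, …, a_n)`, `b = (b_1, …, b_p)`, `c = (c_1, …, c_m)`, `d = (d_1, …, d_q)` and upper indices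
`(m, n)`, lower indices `(n + p, m + q)`; the contour is the upward line `s = r + i t`, where `r` is
to satisfy `Separates r a c`. -/
def meijerG (r : ℝ) (a b c d : List ℂ) (x : ℝ) : ℂ :=
  1 / (2 * (Real.pi : ℂ)) * ∫ t : ℝ, meijerIntegrand a b c d x ((r : ℂ) + t * Complex.I)

end ZFMimo

end

open ZFMimo

/-! ### Iterated derivatives of `x ^ k * ω x` -/

/-! Write `n = n_t`, and let `v` be the `k`-th column of `(√Σ_t)⁻¹`, so that `|v|² = σ_k`. Since
`P†P` is distributed as `U†ΛU`, the SINR has the law of `δ / ∑ Λ_i⁻¹ |(Uv)_i|²`. This law is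
identified through the generalized Stieltjes transform `z ↦ E[(γ/(γ+z))^n]`. The exponent `n` is the
one for which the Haar average is explicit: a Gaussian integral gives `E_U[(1 + ∑ a_i
|(Uv)_i|²/|v|²)^(-n)] = ∏ (1 + a_i)⁻¹` (`lintegral_haarUnitary_inv_pow`). With `a_i = c/Λ_i` and `c
= σ_k z/δ`, what remains is the eigenvalue average of `∏ Λ_i/(Λ_i + c)`.

Andréief's identity and biorthonormality reduce that average to the single integral `∫ y/(y+c)
K(0,y) dy` (`integral_eigenDensity_mul_prod`). Here `K(0,y)` is `1/Mω(1)` times the sum of `∂^j[y^j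
ω]/j!`. Moving all derivatives onto `y/(y+c)`, the sum over `j` telescopes and yields `1/Mω(1) ∫
(y/(y+c))^n ω(y) dy` (`integral_div_add_mul_polyaKernel`). The same power `n` appears on both sides,
so after rescaling `y` the two transforms are those of the law of `γ_k` and of the claimed density.
The dependence on `n` cancels because the transform determines a finite measure on the half-line
(`Measure.ext_of_integral_div_add_pow`). The nonnegativity of the density is part of the conclusion
(`eq_withDensity_of_integral_div_add_pow`).

For the sum rate, the Meijer function in the statement is `ln(1+x)`: its integrand reduces to
`Γ(s)Γ(1-s)/s · x^s`, and `Γ(s)Γ(1-s)/s` is the Mellin transform of `ln(1+1/x)`, which is then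
inverted (`meijerG_eq_log`). Integrating `ln(1+γ)` against the density and rescaling gives the
formula. With `Σ_t = 1` all `σ_k` equal `1` and the summands coincide. -/

theorem ContDiffOn.iteratedDeriv_of_isOpen {F : ℝ → ℝ} {s : Set ℝ} (hs : IsOpen s) (m : ℕ) :
    ∀ j : ℕ, ContDiffOn ℝ ((j + m : ℕ) : WithTop ℕ∞) F s →
      ContDiffOn ℝ (j : WithTop ℕ∞) (iteratedDeriv m F) s := by
  induction m with
  | zero => intro j h; simpa using h
  | succ m ih =>
    intro j h
    rw [iteratedDeriv_succ]
    refine (ih (j + 1) (by rwa [add_right_comm, add_assoc])).deriv_of_isOpen hs ?_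
    norm_cast

/-- Leibniz rule with only two terms, because the second derivative of `x` vanishes. At `b = 0` the
truncated index `b - 1` is harmless, as its coefficient is `0`. -/
theorem iteratedDeriv_id_mul_of_contDiffOn {s : Set ℝ} (hs : IsOpen s) {F : ℝ → ℝ} (b : ℕ)
    (hF : ContDiffOn ℝ (b : WithTop ℕ∞) F s) {y : ℝ} (hy : y ∈ s) :
    iteratedDeriv b (fun x => x * F x) y =
      y * iteratedDeriv b F y + b * iteratedDeriv (b - 1) F y := by
  have h := iteratedDeriv_fun_mul (n := b) (x := y) (f := fun x : ℝ => x) (g := F)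
    contDiffAt_id (hF.contDiffAt (hs.mem_nhds hy))
  rw [h]
  rcases b with _ | b
  · simp
  · rw [Finset.sum_range_succ', Finset.sum_range_succ']
    simp [iteratedDeriv_fun_id]
    ring

/-- The Leibniz rule one order beyond the available smoothness. Mere differentiability of the `b`-th
derivative at the point suffices, which is what local absolute continuity supplies almost
everywhere. -/
theorem hasDerivAt_iteratedDeriv_id_mul {s : Set ℝ} (hs : IsOpen s) {F : ℝ → ℝ} (b : ℕ)
    (hF : ContDiffOn ℝ (b : WithTop ℕ∞) F s) {y : ℝ} (hy : y ∈ s)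
    (hd : DifferentiableAt ℝ (iteratedDeriv b F) y) :
    HasDerivAt (iteratedDeriv b (fun x => x * F x))
      (y * iteratedDeriv (b + 1) F y + (b + 1) * iteratedDeriv b F y) y := by
  have heq : iteratedDeriv b (fun x => x * F x) =ᶠ[nhds y]
      fun x => x * iteratedDeriv b F x + b * iteratedDeriv (b - 1) F x := by
    filter_upwards [hs.mem_nhds hy] with x hx
    exact iteratedDeriv_id_mul_of_contDiffOn hs b hF hx
  have h1 : HasDerivAt (fun x => x * iteratedDeriv b F x)
      (1 * iteratedDeriv b F y + y * iteratedDeriv (b + 1) F y) y := by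
    rw [iteratedDeriv_succ]
    exact (hasDerivAt_id y).mul hd.hasDerivAt
  have h2 : HasDerivAt (fun x => (b : ℝ) * iteratedDeriv (b - 1) F x)
      (b * iteratedDeriv b F y) y := by
    rcases b with _ | b
    · simpa using hasDerivAt_const y (0 : ℝ)
    · refine HasDerivAt.const_mul _ ?_
      have : DifferentiableAt ℝ (iteratedDeriv b F) y :=
        ((ContDiffOn.iteratedDeriv_of_isOpen hs b 1 (by rwa [add_comm])).contDiffAt
          (hs.mem_nhds hy)).differentiableAt (by simp)
      simpa [iteratedDeriv_succ] using this.hasDerivAt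
  refine ((h1.add h2).congr_of_eventuallyEq heq).congr_deriv ?_
  ring

theorem AbsolutelyContinuousOnInterval.congr_uIcc {f g : ℝ → ℝ} {a b : ℝ}
    (hf : AbsolutelyContinuousOnInterval f a b) (h : EqOn f g (uIcc a b)) :
    AbsolutelyContinuousOnInterval g a b := by
  rw [absolutelyContinuousOnInterval_iff] at hf ⊢
  intro ε hε
  obtain ⟨δ, hδ, H⟩ := hf ε hε
  refine ⟨δ, hδ, fun E hE hlt => ?_⟩
  refine lt_of_eq_of_lt (Finset.sum_congr rfl fun i hi => ?_) (H E hE hlt)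
  rw [h (hE.1 i hi).1, h (hE.1 i hi).2]

namespace ZFMimo

theorem uIcc_subset_Ioi {a b : ℝ} (ha : 0 < a) (hab : a ≤ b) : uIcc a b ⊆ Ioi 0 := by
  rw [uIcc_of_le hab]
  exact fun x hx => lt_of_lt_of_le ha hx.1

theorem absolutelyContinuousOnInterval_of_contDiffOn_Ioi {f : ℝ → ℝ}
    (hf : ContDiffOn ℝ 1 f (Ioi 0)) {a b : ℝ} (ha : 0 < a) (hab : a ≤ b) :
    AbsolutelyContinuousOnInterval f a b :=
  (hf.mono (uIcc_subset_Ioi ha hab)).absolutelyContinuousOnInterval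

/-! ### Regularity of the weight and the kernel at `x = 0`. -/

section Weight

variable {n : ℕ} {ω : ℝ → ℝ}

theorem IsPolyaWeight.contDiffOn_pow_mul (h : IsPolyaWeight n ω) {b : ℕ} (hb : b ≤ n - 2)
    (k : ℕ) : ContDiffOn ℝ (b : WithTop ℕ∞) (fun x => x ^ k * ω x) (Ioi 0) :=
  (contDiff_id.pow k).contDiffOn.mul (h.contDiffOn.of_le (by exact_mod_cast hb))

/-- Below the top order this is continuous differentiability. At order `n - 2` the Leibniz formula
carries differentiability from `x^k ω` to `x^(k+1) ω`. -/
theorem IsPolyaWeight.differentiableAt_iteratedDeriv (h : IsPolyaWeight n ω) {b : ℕ}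
    (hb : b ≤ n - 2) (k : ℕ) {y : ℝ} (hy : 0 < y)
    (hd : DifferentiableAt ℝ (iteratedDeriv (n - 2) ω) y) :
    DifferentiableAt ℝ (iteratedDeriv b (fun x => x ^ k * ω x)) y := by
  rcases hb.lt_or_eq with hb | rfl
  · exact ((ContDiffOn.iteratedDeriv_of_isOpen isOpen_Ioi b 1
      (by simpa [add_comm] using h.contDiffOn_pow_mul (b := b + 1) hb k)).contDiffAt
        (isOpen_Ioi.mem_nhds hy)).differentiableAt (by simp)
  · induction k with
    | zero => simpa using hd
    | succ k ih =>
      simp only [pow_succ', mul_assoc]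
      exact (hasDerivAt_iteratedDeriv_id_mul isOpen_Ioi _ (h.contDiffOn_pow_mul le_rfl k)
        hy ih).differentiableAt

theorem IsPolyaWeight.absolutelyContinuousOnInterval (h : IsPolyaWeight n ω) {b : ℕ}
    (hb : b ≤ n - 2) (k : ℕ) {u v : ℝ} (hu : 0 < u) (huv : u ≤ v) :
    AbsolutelyContinuousOnInterval (iteratedDeriv b (fun x => x ^ k * ω x)) u v := by
  have hC1 : ∀ c < n - 2, ∀ k, AbsolutelyContinuousOnInterval
      (iteratedDeriv c (fun x => x ^ k * ω x)) u v := fun c hc k =>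
    absolutelyContinuousOnInterval_of_contDiffOn_Ioi
      (ContDiffOn.iteratedDeriv_of_isOpen isOpen_Ioi c 1
        (by simpa [add_comm] using h.contDiffOn_pow_mul (b := c + 1) hc k)) hu huv
  rcases hb.lt_or_eq with hb | rfl
  · exact hC1 b hb k
  · induction k with
    | zero => simpa using h.locallyAC u v hu huv
    | succ k ih =>
      have hid : AbsolutelyContinuousOnInterval (fun x : ℝ => x) u v :=
        absolutelyContinuousOnInterval_of_contDiffOn_Ioi contDiff_id.contDiffOn hu huv
      have h2 : AbsolutelyContinuousOnInterval (fun x => ((n - 2 : ℕ) : ℝ) *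
          iteratedDeriv (n - 2 - 1) (fun x => x ^ k * ω x) x) u v := by
        -- If `n - 2 = 0`, the index `n - 2 - 1` truncates and `hC1` does not apply, but then the
        -- coefficient is zero.
        rcases Nat.eq_zero_or_pos (n - 2) with h0 | h0
        · rw [h0]
          simpa using absolutelyContinuousOnInterval_of_contDiffOn_Ioi
            (contDiff_const (c := (0 : ℝ))).contDiffOn hu huv
        · exact (hC1 (n - 2 - 1) (by omega) k).const_mul _
      refine ((hid.mul ih).add h2).congr_uIcc fun x hx => ?_
      simp only [pow_succ', mul_assoc]
      exact (iteratedDeriv_id_mul_of_contDiffOn isOpen_Ioi _ (h.contDiffOn_pow_mul le_rfl k)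
        (uIcc_subset_Ioi hu huv hx)).symm

/-- `∂^b [x^b ω]`. -/
noncomputable def weightDeriv (ω : ℝ → ℝ) (b : ℕ) : ℝ → ℝ :=
  iteratedDeriv b (fun x => x ^ b * ω x)

theorem polyaQ_eq (ω : ℝ → ℝ) (l : ℕ) (y : ℝ) :
    polyaQ ω l y = (-1) ^ l / ((l ! : ℝ) * mellinAt ω (l + 1)) * weightDeriv ω l y := by
  have : (fun x : ℝ => (-x) ^ l * ω x) = fun x => (-1) ^ l * (x ^ l * ω x) := by
    ext x; rw [neg_pow]; ring
  rw [polyaQ, this, iteratedDeriv_const_mul_field, weightDeriv]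
  ring

/-- With `w_b = ∂^b[x^b ω]`, the recursion `w_{b+1} = y w_b' + (b+1) w_b` comes from `x^(b+1) ω = x
· (x^b ω)`. It drives the integrations by parts below. -/
theorem IsPolyaWeight.hasDerivAt_weightDeriv (h : IsPolyaWeight n ω) {b : ℕ} (hb : b ≤ n - 2)
    {y : ℝ} (hy : 0 < y) (hd : DifferentiableAt ℝ (iteratedDeriv (n - 2) ω) y) :
    HasDerivAt (weightDeriv ω b) (deriv (weightDeriv ω b) y) y ∧
      weightDeriv ω (b + 1) y = y * deriv (weightDeriv ω b) y + (b + 1) * weightDeriv ω b y := by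
  have hdb := h.differentiableAt_iteratedDeriv hb b hy hd
  refine ⟨hdb.hasDerivAt, ?_⟩
  have := (hasDerivAt_iteratedDeriv_id_mul isOpen_Ioi b (h.contDiffOn_pow_mul hb b) hy hdb).deriv
  simp only [weightDeriv, pow_succ', mul_assoc]
  rw [iteratedDeriv_succ, this, iteratedDeriv_succ]

/-- The right-hand side telescopes: the Leibniz rule applied to `x · (x^(b+1) ω)`, divided by
`(b+1)! y`, says that passing from `b` to `b + 1` adds exactly `w_{b+1}/(b+1)!`. -/
theorem IsPolyaWeight.sum_weightDeriv (h : IsPolyaWeight n ω) {b : ℕ} (hb : b ≤ n - 1)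
    {y : ℝ} (hy : 0 < y) (hd : DifferentiableAt ℝ (iteratedDeriv (n - 2) ω) y) :
    ∑ j ∈ Finset.range (b + 1), weightDeriv ω j y / (j ! : ℝ) =
      1 / (b ! : ℝ) * (1 / y) * iteratedDeriv b (fun x => x ^ (b + 1) * ω x) y := by
  induction b with
  | zero => simp [weightDeriv]; field_simp
  | succ b ih =>
    have hb' : b ≤ n - 2 := by omega
    rw [Finset.sum_range_succ, ih (by omega)]
    have h1 := (hasDerivAt_iteratedDeriv_id_mul isOpen_Ioi b (h.contDiffOn_pow_mul hb' (b + 1)) hy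
      (h.differentiableAt_iteratedDeriv hb' (b + 1) hy hd)).deriv
    have h2 : iteratedDeriv (b + 1) (fun x => x ^ (b + 1 + 1) * ω x) y =
        y * weightDeriv ω (b + 1) y +
          (b + 1) * iteratedDeriv b (fun x => x ^ (b + 1) * ω x) y := by
      rw [iteratedDeriv_succ]
      simp only [pow_succ' _ (b + 1), mul_assoc]
      exact h1
    rw [h2, Nat.factorial_succ]
    push_cast
    have : (b ! : ℝ) ≠ 0 := by positivity
    field_simp
    ring

theorem eval_zero_polyaP (ω : ℝ → ℝ) (l : ℕ) :
    (polyaP ω l).eval 0 = (-1) ^ l * mellinAt ω (l + 1) / mellinAt ω 1 := by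
  rw [polyaP, Polynomial.eval_finsetSum, Finset.sum_range_succ']
  have : (l ! : ℝ) ≠ 0 := by positivity
  simp
  field_simp

/-- The sign and the Mellin transform in `p_j(0) = (-1)^j Mω(j+1)/Mω(1)` cancel against those in
`q_j`. -/
theorem IsPolyaWeight.polyaKernel_zero (h : IsPolyaWeight n ω) (y : ℝ) :
    polyaKernel n ω 0 y =
      1 / mellinAt ω 1 * ∑ j ∈ Finset.range n, weightDeriv ω j y / (j ! : ℝ) := by
  rw [polyaKernel, kernel, Finset.mul_sum]
  refine Finset.sum_congr rfl fun j hj => ?_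
  have := h.mellin_ne_zero j (Finset.mem_range.1 hj)
  rw [eval_zero_polyaP, polyaQ_eq]
  have h1 : ((-1 : ℝ) ^ j) * (-1) ^ j = 1 := by rw [← mul_pow]; simp
  calc (-1) ^ j * mellinAt ω (j + 1) / mellinAt ω 1 *
        ((-1) ^ j / ((j ! : ℝ) * mellinAt ω (j + 1)) * weightDeriv ω j y)
      = ((-1 : ℝ) ^ j * (-1) ^ j) * (mellinAt ω (j + 1) / mellinAt ω (j + 1)) *
          (1 / mellinAt ω 1 * (weightDeriv ω j y / (j ! : ℝ))) := by ring
    _ = _ := by rw [h1, div_self this]; ring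

theorem IsPolyaWeight.polyaKernel_zero_eq (h : IsPolyaWeight n ω) (hn : 2 ≤ n) {y : ℝ}
    (hy : 0 < y) (hd : DifferentiableAt ℝ (iteratedDeriv (n - 2) ω) y) :
    polyaKernel n ω 0 y = 1 / (((n - 1)! : ℝ) * mellinAt ω 1) * (1 / y) *
      iteratedDeriv (n - 1) (fun x => x ^ n * ω x) y := by
  obtain ⟨m, rfl⟩ : ∃ m, n = m + 1 := ⟨n - 1, by omega⟩
  rw [h.polyaKernel_zero, h.sum_weightDeriv (b := m) (by omega) hy hd]
  simp only [Nat.add_sub_cancel]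
  rw [one_div_mul_eq_div, one_div_mul_eq_div]
  ring

/-- Absolutely continuous functions are differentiable almost everywhere; the half-line is exhausted
by the countably many intervals `[1/(k+1), k+1]`. -/
theorem IsPolyaWeight.ae_differentiableAt (h : IsPolyaWeight n ω) :
    ∀ᵐ y : ℝ, 0 < y → DifferentiableAt ℝ (iteratedDeriv (n - 2) ω) y := by
  have : ∀ k : ℕ, ∀ᵐ y : ℝ, y ∈ uIcc ((1 : ℝ) / (k + 1)) (k + 1) →
      DifferentiableAt ℝ (iteratedDeriv (n - 2) ω) y := fun k => by
    refine (h.locallyAC _ _ (by positivity) ?_).ae_differentiableAt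
    rw [div_le_iff₀ (by positivity)]
    nlinarith [(Nat.cast_nonneg k : (0 : ℝ) ≤ k)]
  filter_upwards [ae_all_iff.2 this] with y hy hy0
  obtain ⟨k, hk⟩ := exists_nat_gt (max y (1 / y))
  refine hy k ?_
  have h1 : y < k := (le_max_left _ _).trans_lt hk
  have h2 : 1 / y < k := (le_max_right _ _).trans_lt hk
  rw [mem_uIcc]
  left
  refine ⟨?_, by linarith⟩
  rw [div_le_iff₀ (by positivity)]
  rw [div_lt_iff₀ hy0] at h2
  nlinarith

end Weight

end ZFMimo

/-! ### Integration by parts on the half-line without boundary terms -/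

theorem norm_inv_le_of_lt_abs {c x y : ℝ} (hc : 0 < c) (h : c < |x|) :
    ‖y⁻¹‖ ≤ ‖c⁻¹ * (x / y)‖ := by
  rw [norm_mul, norm_div, norm_inv, norm_inv, Real.norm_of_nonneg hc.le, ← mul_div_assoc,
    inv_mul_eq_div, inv_eq_one_div]
  refine div_le_div_of_nonneg_right ?_ (norm_nonneg y)
  rw [one_le_div hc]
  exact h.le

/-- A nonzero limit would make `f(y)/y` dominate a multiple of `1/y`, which is not integrable at
infinity. The companion lemma uses the same divergence at zero. -/
theorem eq_zero_of_tendsto_atTop_of_integrableOn_div {f : ℝ → ℝ} {L : ℝ}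
    (hf : IntegrableOn (fun y => f y / y) (Ioi 0)) (hL : Filter.Tendsto f Filter.atTop (nhds L)) :
    L = 0 := by
  by_contra hne
  have hpos : 0 < |L| := abs_pos.2 hne
  obtain ⟨a, ha⟩ := Filter.eventually_atTop.1
    ((hL.abs.eventually (lt_mem_nhds (half_lt_self hpos))).and (Filter.eventually_gt_atTop 0))
  have ha0 : 0 < a := (ha a le_rfl).2
  refine not_integrableOn_Ioi_inv (a := a) ?_
  have h1 : IntegrableOn (fun y => (|L| / 2)⁻¹ * (f y / y)) (Ioi a) :=
    (hf.mono_set (Ioi_subset_Ioi ha0.le)).const_mul _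
  refine Integrable.mono h1 (by fun_prop) ?_
  filter_upwards [ae_restrict_mem measurableSet_Ioi] with y hy
  obtain ⟨h2, h3⟩ := ha y (le_of_lt hy)
  exact norm_inv_le_of_lt_abs (half_pos hpos) h2

theorem eq_zero_of_tendsto_zero_of_integrableOn_div {f : ℝ → ℝ} {L : ℝ}
    (hf : IntegrableOn (fun y => f y / y) (Ioi 0))
    (hL : Filter.Tendsto f (nhdsWithin 0 (Ioi 0)) (nhds L)) :
    L = 0 := by
  by_contra hne
  have hpos : 0 < |L| := abs_pos.2 hne
  obtain ⟨a, ha0, ha⟩ := mem_nhdsGT_iff_exists_Ioc_subset.1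
    (hL.abs.eventually (lt_mem_nhds (half_lt_self hpos)))
  have ha0 : 0 < a := ha0
  have key : ¬ IntervalIntegrable (fun y : ℝ => y⁻¹) volume 0 a := by
    rw [intervalIntegrable_inv_iff]
    simp [ha0.ne, ha0.le]
  refine key ((intervalIntegrable_iff_integrableOn_Ioc_of_le ha0.le).2 ?_)
  have h1 : IntegrableOn (fun y => (|L| / 2)⁻¹ * (f y / y)) (Ioc 0 a) :=
    (hf.mono_set Ioc_subset_Ioi_self).const_mul _
  refine Integrable.mono h1 (by fun_prop) ?_
  filter_upwards [ae_restrict_mem measurableSet_Ioc] with y hy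
  have h2 : |L| / 2 < |f y| := ha hy
  exact norm_inv_le_of_lt_abs (half_pos hpos) h2

/-- Integrability of `f'` gives `f` limits at both ends, and integrability of `f(y)/y` forces both
limits to vanish. Hence boundary terms disappear without any decay assumption on `f`. -/
theorem integral_Ioi_deriv_eq_zero_of_absolutelyContinuous {f : ℝ → ℝ}
    (hAC : ∀ u v : ℝ, 0 < u → u ≤ v → AbsolutelyContinuousOnInterval f u v)
    (hd : IntegrableOn (deriv f) (Ioi 0)) (hf : IntegrableOn (fun y => f y / y) (Ioi 0)) :
    ∫ y in Ioi (0 : ℝ), deriv f y = 0 := by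
  have hd1 : IntegrableOn (deriv f) (Ioi 1) := hd.mono_set (Ioi_subset_Ioi zero_le_one)
  have hd0 : IntegrableOn (deriv f) (Ioc 0 1) := hd.mono_set Ioc_subset_Ioi_self
  have htop : Filter.Tendsto f Filter.atTop
      (nhds (f 1 + ∫ y in Ioi (1 : ℝ), deriv f y)) := by
    have h := (intervalIntegral_tendsto_integral_Ioi 1 hd1 Filter.tendsto_id).const_add (f 1)
    refine h.congr' ?_
    filter_upwards [Filter.eventually_ge_atTop 1] with v hv
    rw [id, (hAC 1 v one_pos hv).integral_deriv_eq_sub]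
    ring
  have hbot : Filter.Tendsto f (nhdsWithin 0 (Ioi 0))
      (nhds (f 1 - ∫ y in Ioc (0 : ℝ) 1, deriv f y)) := by
    have hint : IntervalIntegrable (deriv f) volume 1 0 :=
      ((intervalIntegrable_iff_integrableOn_Ioc_of_le zero_le_one).2 hd0).symm
    have hcont := intervalIntegral.continuousOn_primitive_interval'
      (a := (1 : ℝ)) hint left_mem_uIcc
    have h0 : Filter.Tendsto (fun u => ∫ y in (1 : ℝ)..u, deriv f y) (nhdsWithin 0 (Ioi 0))
        (nhds (∫ y in (1 : ℝ)..0, deriv f y)) := by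
      refine (hcont 0 right_mem_uIcc).mono_left ?_
      rw [uIcc_of_ge zero_le_one, ← nhdsWithin_Ioc_eq_nhdsGT (zero_lt_one' ℝ)]
      exact nhdsWithin_mono _ Ioc_subset_Icc_self
    rw [intervalIntegral.integral_of_ge zero_le_one] at h0
    rw [sub_eq_add_neg]
    refine (h0.const_add (f 1)).congr' ?_
    filter_upwards [Ioc_mem_nhdsGT (zero_lt_one' ℝ)] with u hu
    rw [(hAC u 1 hu.1 hu.2).symm.integral_deriv_eq_sub]
    ring
  have e1 := eq_zero_of_tendsto_atTop_of_integrableOn_div hf htop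
  have e2 := eq_zero_of_tendsto_zero_of_integrableOn_div hf hbot
  rw [← Ioc_union_Ioi_eq_Ioi (zero_le_one' ℝ),
    setIntegral_union (Ioc_disjoint_Ioi le_rfl) measurableSet_Ioi hd0 hd1]
  linarith

namespace ZFMimo

/-! ### Moments of the functions `q_l` and biorthonormality. -/

section Weight

variable {n : ℕ} {ω : ℝ → ℝ}

/-- Integration by parts with the primitive `f = y G w_j`. By the recursion for `w_{j+1}`, `f' = G
w_{j+1} - (j G - y G') w_j` almost everywhere, while `f/y = G w_j` is integrable. Each derivative in
the weight thus becomes the operator `j - y∂_y` on the test function. -/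
theorem IsPolyaWeight.integral_mul_weightDeriv_succ (h : IsPolyaWeight n ω) {j : ℕ}
    (hj : j ≤ n - 2) {G G' : ℝ → ℝ} (hG : ∀ y, 0 < y → HasDerivAt G (G' y) y)
    (hG' : ContinuousOn G' (Ioi 0))
    (i0 : IntegrableOn (fun y => G y * weightDeriv ω j y) (Ioi 0))
    (i1 : IntegrableOn (fun y => G y * weightDeriv ω (j + 1) y) (Ioi 0))
    (i2 : IntegrableOn (fun y => y * G' y * weightDeriv ω j y) (Ioi 0)) :
    ∫ y in Ioi (0 : ℝ), G y * weightDeriv ω (j + 1) y =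
      ∫ y in Ioi (0 : ℝ), (j * G y - y * G' y) * weightDeriv ω j y := by
  have hGC : ContDiffOn ℝ 1 G (Ioi 0) := by
    rw [show (1 : WithTop ℕ∞) = 0 + 1 by rfl, contDiffOn_succ_iff_deriv_of_isOpen isOpen_Ioi]
    refine ⟨fun y hy => (hG y hy).differentiableAt.differentiableWithinAt, by simp, ?_⟩
    rw [contDiffOn_zero]
    exact hG'.congr fun y hy => (hG y hy).deriv
  have hderiv : ∀ᵐ y ∂(volume.restrict (Ioi (0 : ℝ))),
      deriv (fun y => y * G y * weightDeriv ω j y) y =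
        G y * weightDeriv ω (j + 1) y - (j * G y - y * G' y) * weightDeriv ω j y := by
    filter_upwards [ae_restrict_mem measurableSet_Ioi, ae_restrict_of_ae h.ae_differentiableAt]
      with y hy hd
    obtain ⟨h1, h2⟩ := h.hasDerivAt_weightDeriv hj hy (hd hy)
    rw [(((hasDerivAt_id' y).fun_mul (hG y hy)).fun_mul h1).deriv, h2]
    ring
  have i3 : IntegrableOn (fun y => (j * G y - y * G' y) * weightDeriv ω j y) (Ioi 0) := by
    refine ((i0.const_mul (j : ℝ)).sub i2).congr (Filter.Eventually.of_forall fun y => ?_)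
    simp only [Pi.sub_apply]
    ring
  have hint : IntegrableOn (deriv (fun y => y * G y * weightDeriv ω j y)) (Ioi 0) :=
    (i1.sub i3).congr (hderiv.mono fun y hy => hy.symm)
  have h0 := integral_Ioi_deriv_eq_zero_of_absolutelyContinuous
    (f := fun y => y * G y * weightDeriv ω j y)
    (fun u v hu huv => (absolutelyContinuousOnInterval_of_contDiffOn_Ioi
        (contDiff_id.contDiffOn.mul hGC) hu huv).mul
      (h.absolutelyContinuousOnInterval hj j hu huv)) hint
    (i0.congr (by
      filter_upwards [ae_restrict_mem measurableSet_Ioi] with y hy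
      have : y ≠ 0 := ne_of_gt hy
      field_simp))
  rw [integral_congr_ae hderiv, integral_sub i1 i3] at h0
  linarith

theorem IsPolyaWeight.integrableOn_pow_mul (h : IsPolyaWeight n ω) {a b : ℕ} (ha : a < n)
    (hb : b < n) : IntegrableOn (fun y => y ^ a * weightDeriv ω b y) (Ioi 0) :=
  h.integrableOn a ha b hb

theorem mellinAt_natCast_add_one (ω : ℝ → ℝ) (a : ℕ) :
    mellinAt ω (a + 1) = ∫ x in Ioi (0 : ℝ), x ^ a * ω x := by
  simp [mellinAt]

/-- On `y^a` the operator `j - y∂_y` is multiplication by `j - a`; the product over `j < b` is the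
signed falling factorial. -/
theorem IsPolyaWeight.integral_pow_mul_weightDeriv (h : IsPolyaWeight n ω) {a b : ℕ} (ha : a < n)
    (hb : b < n) : ∫ y in Ioi (0 : ℝ), y ^ a * weightDeriv ω b y =
      (-1) ^ b * (a.descFactorial b : ℝ) * mellinAt ω (a + 1) := by
  induction b with
  | zero => simp [weightDeriv, mellinAt_natCast_add_one]
  | succ b ih =>
    have key : ∀ y : ℝ, y * (a * y ^ (a - 1)) = a * y ^ a := fun y => by
      rcases a with _ | a
      · simp
      · simp [pow_succ]; ring
    have i0 := h.integrableOn_pow_mul ha (b := b) (by omega)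
    rw [h.integral_mul_weightDeriv_succ (j := b) (G := fun y => y ^ a)
      (G' := fun y => a * y ^ (a - 1)) (by omega) (fun y _ => hasDerivAt_pow a y) (by fun_prop)
      i0 (h.integrableOn_pow_mul ha hb) (by
        simp only [key, mul_assoc]
        exact Integrable.const_mul i0 (a : ℝ))]
    simp only [key, ← sub_mul]
    simp only [mul_assoc]
    rw [integral_const_mul, ih (by omega), Nat.descFactorial_succ]
    -- For `b > a` the natural subtraction `a - b` truncates, but there the falling factorial of
    -- order `b` is already zero.
    rcases le_or_gt b a with hba | hba
    · push_cast [Nat.cast_sub hba]; ring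
    · rw [Nat.descFactorial_of_lt hba]; simp

theorem IsPolyaWeight.integrableOn_pow_mul_polyaQ (h : IsPolyaWeight n ω) {a b : ℕ} (ha : a < n)
    (hb : b < n) : IntegrableOn (fun y => y ^ a * polyaQ ω b y) (Ioi 0) := by
  simp only [polyaQ_eq, mul_left_comm _ (_ / _)]
  exact (h.integrableOn_pow_mul ha hb).const_mul _

theorem IsPolyaWeight.integral_pow_mul_polyaQ (h : IsPolyaWeight n ω) {a b : ℕ} (ha : a < n)
    (hb : b < n) : ∫ y in Ioi (0 : ℝ), y ^ a * polyaQ ω b y =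
      (a.choose b : ℝ) * mellinAt ω (a + 1) / mellinAt ω (b + 1) := by
  have hM := h.mellin_ne_zero b hb
  simp only [polyaQ_eq, mul_left_comm _ (_ / _)]
  rw [integral_const_mul, h.integral_pow_mul_weightDeriv ha hb, Nat.descFactorial_eq_factorial_mul_choose]
  have h1 : ((-1 : ℝ) ^ b) * (-1) ^ b = 1 := by rw [← mul_pow]; simp
  have h2 : (b ! : ℝ) ≠ 0 := by positivity
  push_cast
  calc (-1) ^ b / ((b ! : ℝ) * mellinAt ω (b + 1)) *
        ((-1) ^ b * ((b ! : ℝ) * (a.choose b : ℝ)) * mellinAt ω (a + 1))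
      = ((-1 : ℝ) ^ b * (-1) ^ b) * ((b ! : ℝ) / (b ! : ℝ)) *
          ((a.choose b : ℝ) * mellinAt ω (a + 1) / mellinAt ω (b + 1)) := by ring
    _ = _ := by rw [h1, div_self h2]; ring

/-- Binomial inversion: `C(a,j) C(j,b) = C(a,b) C(a-b,j-b)` reduces the sum to the expansion of `(1
- 1)^(a-b)`. -/
theorem sum_neg_one_pow_mul_choose_mul_choose (a b : ℕ) :
    ∑ j ∈ Finset.range (a + 1), (-1 : ℝ) ^ (a - j) * (a.choose j : ℝ) * (j.choose b : ℝ) =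
      if a = b then 1 else 0 := by
  rcases lt_or_ge a b with hab | hab
  · rw [if_neg hab.ne]
    refine Finset.sum_eq_zero fun j hj => ?_
    rw [Nat.choose_eq_zero_of_lt (by rw [Finset.mem_range] at hj; omega : j < b)]
    simp
  · obtain ⟨m, rfl⟩ := Nat.exists_eq_add_of_le hab
    rw [add_assoc, Finset.sum_range_add, Finset.sum_eq_zero, zero_add]
    · have h1 : ∀ i ∈ Finset.range (m + 1), (-1 : ℝ) ^ (b + m - (b + i)) *
          ((b + m).choose (b + i) : ℝ) * ((b + i).choose b : ℝ) =
          ((b + m).choose b : ℝ) * (1 ^ i * (-1 : ℝ) ^ (m - i) * (m.choose i : ℝ)) := by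
        intro i hi
        rw [Finset.mem_range] at hi
        have := Nat.choose_mul (n := b + m) (k := b + i) (s := b) (by omega)
        rw [Nat.add_sub_cancel_left, Nat.add_sub_cancel_left] at this
        have h2 : ((b + m).choose (b + i) : ℝ) * ((b + i).choose b : ℝ) =
          ((b + m).choose b : ℝ) * (m.choose i : ℝ) := by exact_mod_cast this
        rw [Nat.add_sub_add_left, one_pow]
        linear_combination (-1 : ℝ) ^ (m - i) * h2
      rw [Finset.sum_congr rfl h1, ← Finset.mul_sum, ← add_pow]
      rcases m with _ | m <;> simp
    · intro j hj
      rw [Nat.choose_eq_zero_of_lt (Finset.mem_range.1 hj)]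
      simp

theorem degree_sum_polyaP_lt (ω : ℝ → ℝ) (l : ℕ) :
    (∑ j ∈ Finset.range l, Polynomial.C ((-1) ^ (l - j) * (l ! : ℝ) * mellinAt ω (l + 1) /
      ((j ! : ℝ) * ((l - j)! : ℝ) * mellinAt ω (j + 1))) * Polynomial.X ^ j).degree < (l : WithBot ℕ) := by
  refine Polynomial.mem_degreeLT.1 (Submodule.sum_mem _ fun j hj => Polynomial.mem_degreeLT.2 ?_)
  refine (Polynomial.degree_C_mul_X_pow_le _ _).trans_lt ?_
  exact_mod_cast Finset.mem_range.1 hj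

theorem IsPolyaWeight.monic_polyaP (h : IsPolyaWeight n ω) {l : ℕ} (hl : l < n) :
    (polyaP ω l).Monic ∧ (polyaP ω l).natDegree = l := by
  have hM := h.mellin_ne_zero l hl
  have h2 : (l ! : ℝ) ≠ 0 := by positivity
  have heq : polyaP ω l = Polynomial.X ^ l +
      ∑ j ∈ Finset.range l, Polynomial.C ((-1) ^ (l - j) * (l ! : ℝ) * mellinAt ω (l + 1) /
        ((j ! : ℝ) * ((l - j)! : ℝ) * mellinAt ω (j + 1))) * Polynomial.X ^ j := by
    rw [polyaP, Finset.sum_range_succ, add_comm]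
    congr 1
    rw [Nat.sub_self, Nat.factorial_zero, pow_zero]
    simp [div_self (mul_ne_zero h2 hM)]
  have hdeg := degree_sum_polyaP_lt ω l
  rw [heq]
  exact ⟨Polynomial.monic_X_pow_add hdeg,
    by rw [add_comm, Polynomial.natDegree_add_eq_right_of_degree_lt, Polynomial.natDegree_X_pow]
       rwa [Polynomial.degree_X_pow]⟩

theorem eval_polyaP (ω : ℝ → ℝ) (l : ℕ) (x : ℝ) :
    (polyaP ω l).eval x = ∑ j ∈ Finset.range (l + 1),
      ((-1) ^ (l - j) * (l ! : ℝ) * mellinAt ω (l + 1) /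
        ((j ! : ℝ) * ((l - j)! : ℝ) * mellinAt ω (j + 1))) * x ^ j := by
  simp [polyaP, Polynomial.eval_finsetSum]

/-- The factor `1/Mω(j+1)` in the coefficients of `p_a` cancels `Mω(j+1)` in the `j`-th moment of
`q_b`, which leaves the binomial orthogonality relation. -/
theorem IsPolyaWeight.isBiorthonormal (h : IsPolyaWeight n ω) :
    IsBiorthonormal n (polyaP ω) (polyaQ ω) := by
  refine ⟨fun j hj => h.monic_polyaP hj, fun a ha b hb => ?_⟩
  have hint : ∀ j ∈ Finset.range (a + 1), IntegrableOn (fun x =>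
      ((-1) ^ (a - j) * (a ! : ℝ) * mellinAt ω (a + 1) /
        ((j ! : ℝ) * ((a - j)! : ℝ) * mellinAt ω (j + 1))) * (x ^ j * polyaQ ω b x)) (Ioi 0) :=
    fun j hj => (h.integrableOn_pow_mul_polyaQ (by rw [Finset.mem_range] at hj; omega) hb).const_mul _
  have heq : (fun x => (polyaP ω a).eval x * polyaQ ω b x) = fun x =>
      ∑ j ∈ Finset.range (a + 1), ((-1) ^ (a - j) * (a ! : ℝ) * mellinAt ω (a + 1) /
        ((j ! : ℝ) * ((a - j)! : ℝ) * mellinAt ω (j + 1))) * (x ^ j * polyaQ ω b x) := by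
    ext x
    rw [eval_polyaP, Finset.sum_mul]
    simp only [mul_assoc]
  rw [heq]
  refine ⟨integrable_finsetSum _ hint, ?_⟩
  rw [integral_finsetSum _ hint]
  have hterm : ∀ j ∈ Finset.range (a + 1), ∫ x in Ioi (0 : ℝ),
      ((-1) ^ (a - j) * (a ! : ℝ) * mellinAt ω (a + 1) /
        ((j ! : ℝ) * ((a - j)! : ℝ) * mellinAt ω (j + 1))) * (x ^ j * polyaQ ω b x) =
      (mellinAt ω (a + 1) / mellinAt ω (b + 1)) *
        ((-1 : ℝ) ^ (a - j) * (a.choose j : ℝ) * (j.choose b : ℝ)) := by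
    intro j hj
    rw [Finset.mem_range] at hj
    have hM := h.mellin_ne_zero j (by omega)
    have h3 : (j ! : ℝ) ≠ 0 := by positivity
    have h4 : ((a - j)! : ℝ) ≠ 0 := by positivity
    rw [integral_const_mul, h.integral_pow_mul_polyaQ (by omega) hb,
      Nat.cast_choose ℝ (by omega : j ≤ a)]
    field_simp
  rw [Finset.sum_congr rfl hterm, ← Finset.mul_sum, sum_neg_one_pow_mul_choose_mul_choose]
  split_ifs with hab
  · rw [hab, div_self (h.mellin_ne_zero b hb), one_mul]
  · rw [mul_zero]

end Weight

/-! ### Integrals against polynomials in `y / (y + z)` -/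

open Polynomial in
/-- The operator `y ∂_y` on polynomials in `y / (y + z)`. -/
noncomputable def eulerOp : Module.End ℝ ℝ[X] :=
  LinearMap.mulLeft ℝ (X * (1 - X)) ∘ₗ Polynomial.derivative

open Polynomial in
theorem eulerOp_apply (p : ℝ[X]) : eulerOp p = X * (1 - X) * derivative p := rfl

open Polynomial in
/-- `∏_{c < j} (c - X)`. -/
noncomputable def eulerPoly (j : ℕ) : ℝ[X] := ∏ c ∈ Finset.range j, (C (c : ℝ) - X)

open Polynomial in
theorem aeval_eulerPoly_succ_apply (j : ℕ) (p : ℝ[X]) :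
    aeval eulerOp (eulerPoly (j + 1)) p =
      aeval eulerOp (eulerPoly j) ((j : ℝ) • p - eulerOp p) := by
  rw [eulerPoly, Finset.prod_range_succ, map_mul, Module.End.mul_apply, eulerPoly,
    map_sub, aeval_C, aeval_X, LinearMap.sub_apply, Module.algebraMap_end_apply]

open Polynomial in
-- The commuting factors are peeled off from the outside here and from the inside in
-- `aeval_eulerPoly_succ_apply`. The outer form serves the explicit computation on `X`, the inner
-- one the integration by parts.
theorem aeval_eulerPoly_succ_apply' (j : ℕ) (p : ℝ[X]) :
    aeval eulerOp (eulerPoly (j + 1)) p =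
      (j : ℝ) • aeval eulerOp (eulerPoly j) p - eulerOp (aeval eulerOp (eulerPoly j) p) := by
  rw [eulerPoly, Finset.prod_range_succ, mul_comm, map_mul, Module.End.mul_apply, eulerPoly,
    map_sub, aeval_C, aeval_X, LinearMap.sub_apply, Module.algebraMap_end_apply]

open Polynomial in
-- Since `y∂_y` acts on `X^m` as `m(X^m - X^(m+1))`, the operator `m - y∂_y` sends `X^(m+1) - X^m`
-- to `(m+1)(X^(m+2) - X^(m+1))`. After division by the factorial these differences telescope.
theorem aeval_eulerPoly_X (j : ℕ) :
    aeval eulerOp (eulerPoly (j + 1)) (X : ℝ[X]) = ((j + 1)! : ℝ) • (X ^ (j + 2) - X ^ (j + 1)) := by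
  induction j with
  | zero =>
    rw [aeval_eulerPoly_succ_apply']
    simp [eulerPoly, eulerOp_apply]
    ring
  | succ j ih =>
    rw [aeval_eulerPoly_succ_apply', ih, map_smul, eulerOp_apply, Nat.factorial_succ (j + 1)]
    simp only [smul_eq_C_mul, derivative_sub, derivative_X_pow, Nat.cast_mul, C_mul]
    simp only [map_natCast]
    push_cast
    ring

open Polynomial in
theorem sum_aeval_eulerPoly_X (m : ℕ) :
    ∑ j ∈ Finset.range (m + 1), (1 / (j ! : ℝ)) • aeval eulerOp (eulerPoly j) (X : ℝ[X]) =
      X ^ (m + 1) := by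
  induction m with
  | zero => simp [eulerPoly]
  | succ m ih =>
    rw [Finset.sum_range_succ, ih, aeval_eulerPoly_X, smul_smul, one_div, inv_mul_cancel₀
      (by positivity), one_smul]
    ring

theorem div_add_mem_Icc {y z : ℝ} (hy : 0 < y) (hz : 0 < z) : y / (y + z) ∈ Icc (0 : ℝ) 1 :=
  ⟨by positivity, by rw [div_le_one (by positivity)]; linarith⟩

theorem exists_bound_eval_div_add (p : Polynomial ℝ) {z : ℝ} (hz : 0 < z) :
    ∃ B, ∀ y, 0 < y → ‖p.eval (y / (y + z))‖ ≤ B := by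
  obtain ⟨B, hB⟩ := (isCompact_Icc (a := (0 : ℝ)) (b := 1)).exists_bound_of_continuousOn
    p.continuous.continuousOn
  exact ⟨B, fun y hy => hB _ (div_add_mem_Icc hy hz)⟩

theorem integrableOn_eval_div_add_mul (p : Polynomial ℝ) {z : ℝ} (hz : 0 < z) {f : ℝ → ℝ}
    (hf : IntegrableOn f (Ioi 0)) :
    IntegrableOn (fun y => p.eval (y / (y + z)) * f y) (Ioi 0) := by
  obtain ⟨B, hB⟩ := exists_bound_eval_div_add p hz
  refine Integrable.bdd_mul (c := B) hf ?_ ?_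
  · exact (p.continuous.measurable.comp (by fun_prop)).aestronglyMeasurable
  · filter_upwards [ae_restrict_mem measurableSet_Ioi] with y hy using hB y hy

/-! ### The transform of `K(0, ·)` in terms of `ω`. -/

section Weight

variable {n : ℕ} {ω : ℝ → ℝ}

theorem IsPolyaWeight.integrableOn_weightDeriv (h : IsPolyaWeight n ω) {j : ℕ} (hj : j < n) :
    IntegrableOn (weightDeriv ω j) (Ioi 0) := by
  simpa using h.integrableOn_pow_mul (a := 0) (by omega) hj

/-- Functions of the form `p(y/(y+z))` are stable under `y∂_y`, because `t = y/(y+z)` satisfies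
`y∂_y t = t(1 - t)`, and they are bounded on the half-line. So the integration by parts can be
iterated entirely within this class. -/
theorem IsPolyaWeight.integral_eval_mul_weightDeriv (h : IsPolyaWeight n ω) {z : ℝ} (hz : 0 < z)
    {j : ℕ} (hj : j < n) (p : Polynomial ℝ) :
    ∫ y in Ioi (0 : ℝ), p.eval (y / (y + z)) * weightDeriv ω j y =
      ∫ y in Ioi (0 : ℝ), (Polynomial.aeval eulerOp (eulerPoly j) p).eval (y / (y + z)) * ω y := by
  induction j generalizing p with
  | zero => simp [eulerPoly, weightDeriv]
  | succ j ih =>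
    have hEuler : ∀ y, 0 < y → y * (p.derivative.eval (y / (y + z)) * (z / (y + z) ^ 2)) =
        (eulerOp p).eval (y / (y + z)) := fun y hy => by
      rw [eulerOp_apply]
      simp
      field_simp
      ring
    have hderiv : ∀ y, 0 < y → HasDerivAt (fun y => p.eval (y / (y + z)))
        (p.derivative.eval (y / (y + z)) * (z / (y + z) ^ 2)) y := fun y hy => by
      have h1 : HasDerivAt (fun y => y / (y + z)) (z / (y + z) ^ 2) y := by
        have := (hasDerivAt_id' y).fun_div ((hasDerivAt_id' y).add_const z)
          (by positivity : y + z ≠ 0)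
        exact this.congr_deriv (by ring)
      exact (p.hasDerivAt _).comp y h1
    have hcont : ContinuousOn (fun y => p.derivative.eval (y / (y + z)) * (z / (y + z) ^ 2))
        (Ioi 0) := by
      have hne : ∀ y ∈ Ioi (0 : ℝ), y + z ≠ 0 := fun y hy => by
        have : (0 : ℝ) < y := hy
        positivity
      have h1 : ContinuousOn (fun y => y / (y + z)) (Ioi 0) :=
        continuousOn_id.div (by fun_prop) hne
      exact (p.derivative.continuous.comp_continuousOn h1).mul
        (continuousOn_const.div (by fun_prop) fun y hy => pow_ne_zero 2 (hne y hy))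
    have hW := h.integrableOn_weightDeriv (j := j) (by omega)
    rw [h.integral_mul_weightDeriv_succ (j := j) (by omega) hderiv hcont
      (integrableOn_eval_div_add_mul p hz hW)
      (integrableOn_eval_div_add_mul p hz (h.integrableOn_weightDeriv hj))
      ((integrableOn_eval_div_add_mul (eulerOp p) hz hW).congr_fun
        (fun y hy => by simp only [hEuler y hy]) measurableSet_Ioi),
      aeval_eulerPoly_succ_apply, ← ih (by omega)]
    refine setIntegral_congr_fun measurableSet_Ioi fun y hy => ?_
    simp only [hEuler y hy]
    simp

/-- The source of the exponent `n`: summing the images of `X` under `∏_{c<j} (c - y∂_y) / j!` over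
`j < n` telescopes to `X^n`. -/
theorem IsPolyaWeight.integral_div_add_mul_polyaKernel (h : IsPolyaWeight n ω) (hn : 2 ≤ n)
    {z : ℝ} (hz : 0 < z) :
    ∫ y in Ioi (0 : ℝ), y / (y + z) * polyaKernel n ω 0 y =
      1 / mellinAt ω 1 * ∫ y in Ioi (0 : ℝ), (y / (y + z)) ^ n * ω y := by
  obtain ⟨m, rfl⟩ : ∃ m, n = m + 1 := ⟨n - 1, by omega⟩
  have hω : IntegrableOn ω (Ioi 0) := by
    simpa [weightDeriv] using h.integrableOn_weightDeriv (j := 0) (by omega)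
  have hi : ∀ j ∈ Finset.range (m + 1), IntegrableOn (fun y => (1 / (j ! : ℝ)) *
      (Polynomial.eval (y / (y + z)) Polynomial.X * weightDeriv ω j y)) (Ioi 0) := fun j hj =>
    (integrableOn_eval_div_add_mul _ hz
      (h.integrableOn_weightDeriv (Finset.mem_range.1 hj))).const_mul _
  have heq : ∀ y, y / (y + z) * polyaKernel (m + 1) ω 0 y = 1 / mellinAt ω 1 *
      ∑ j ∈ Finset.range (m + 1), (1 / (j ! : ℝ)) *
        (Polynomial.eval (y / (y + z)) Polynomial.X * weightDeriv ω j y) := fun y => by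
    rw [h.polyaKernel_zero, mul_left_comm, Finset.mul_sum]
    congr 1
    refine Finset.sum_congr rfl fun j _ => ?_
    rw [Polynomial.eval_X]
    ring
  simp only [heq]
  rw [integral_const_mul, integral_finsetSum _ hi]
  congr 1
  have hi' : ∀ j ∈ Finset.range (m + 1), IntegrableOn (fun y => (1 / (j ! : ℝ)) *
      ((Polynomial.aeval eulerOp (eulerPoly j) Polynomial.X).eval (y / (y + z)) * ω y)) (Ioi 0) :=
    fun j hj => (integrableOn_eval_div_add_mul _ hz hω).const_mul _
  have h2 : ∀ j ∈ Finset.range (m + 1), ∫ y in Ioi (0 : ℝ), (1 / (j ! : ℝ)) *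
      (Polynomial.eval (y / (y + z)) Polynomial.X * weightDeriv ω j y) =
      ∫ y in Ioi (0 : ℝ), (1 / (j ! : ℝ)) *
        ((Polynomial.aeval eulerOp (eulerPoly j) Polynomial.X).eval (y / (y + z)) * ω y) :=
    fun j hj => by
      rw [integral_const_mul, h.integral_eval_mul_weightDeriv hz (Finset.mem_range.1 hj),
        integral_const_mul]
  rw [Finset.sum_congr rfl h2, ← integral_finsetSum _ hi']
  refine integral_congr_ae (Filter.Eventually.of_forall fun y => ?_)
  have := congrArg (Polynomial.eval (y / (y + z))) (sum_aeval_eulerPoly_X m)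
  simp only [Polynomial.eval_finsetSum, Polynomial.eval_smul, Polynomial.eval_pow,
    Polynomial.eval_X, smul_eq_mul] at this
  simp only [← this, Finset.sum_mul, mul_assoc]

end Weight

end ZFMimo

/-! ### Andréief's identity -/

section Andreief

theorem det_mul_det_eq_sum {n : ℕ} {α : Type*} (f g : Fin n → α → ℝ) (x : Fin n → α) :
    (Matrix.of fun a i => f i (x a)).det * (Matrix.of fun a j => g j (x a)).det =
      ∑ σ : Equiv.Perm (Fin n), ∑ τ : Equiv.Perm (Fin n),
        (((Equiv.Perm.sign σ : ℤ) : ℝ) * ((Equiv.Perm.sign τ : ℤ) : ℝ)) *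
          ∏ a, (f (σ a) (x a) * g (τ a) (x a)) := by
  rw [← Matrix.det_transpose, Matrix.det_apply', ← Matrix.det_transpose, Matrix.det_apply',
    Finset.sum_mul_sum]
  refine Finset.sum_congr rfl fun σ _ => Finset.sum_congr rfl fun τ _ => ?_
  simp only [Matrix.transpose_apply, Matrix.of_apply, Finset.prod_mul_distrib]
  ring

variable {n : ℕ} {α : Type*} [MeasurableSpace α] {μ : Measure α} [SigmaFinite μ]
  {f g : Fin n → α → ℝ}

theorem integrable_det_mul_det (h : ∀ i j, Integrable (fun y => f i y * g j y) μ) :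
    Integrable (fun x : Fin n → α => (Matrix.of fun a i => f i (x a)).det *
      (Matrix.of fun a j => g j (x a)).det) (Measure.pi fun _ => μ) := by
  simp only [det_mul_det_eq_sum]
  exact integrable_finsetSum _ fun σ _ => integrable_finsetSum _ fun τ _ =>
    (Integrable.fintype_prod (f := fun a y => f (σ a) y * g (τ a) y)
      fun a => h (σ a) (τ a)).const_mul _

/-- After expanding both determinants and factorizing the integrals, every permutation `σ` of the
first determinant contributes the same value: permuting the rows of the matrix of integrals by `σ`
gives back the factor `sign σ`. Hence the `n!`. -/
theorem integral_det_mul_det (h : ∀ i j, Integrable (fun y => f i y * g j y) μ) :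
    ∫ x : Fin n → α, (Matrix.of fun a i => f i (x a)).det *
      (Matrix.of fun a j => g j (x a)).det ∂(Measure.pi fun _ => μ) =
      (n ! : ℝ) * (Matrix.of fun i j => ∫ y, f i y * g j y ∂μ).det := by
  have hi : ∀ σ τ : Equiv.Perm (Fin n), Integrable (fun x : Fin n → α =>
      (((Equiv.Perm.sign σ : ℤ) : ℝ) * ((Equiv.Perm.sign τ : ℤ) : ℝ)) *
          ∏ a, (f (σ a) (x a) * g (τ a) (x a))) (Measure.pi fun _ => μ) := fun σ τ =>
    (Integrable.fintype_prod (f := fun a y => f (σ a) y * g (τ a) y)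
      fun a => h (σ a) (τ a)).const_mul _
  simp only [det_mul_det_eq_sum]
  rw [integral_finsetSum _ fun σ _ => integrable_finsetSum _ fun τ _ => hi σ τ]
  have hσ : ∀ σ : Equiv.Perm (Fin n), ∫ x : Fin n → α, ∑ τ : Equiv.Perm (Fin n),
        (((Equiv.Perm.sign σ : ℤ) : ℝ) * ((Equiv.Perm.sign τ : ℤ) : ℝ)) *
          ∏ a, (f (σ a) (x a) * g (τ a) (x a)) ∂(Measure.pi fun _ => μ) =
      (Matrix.of fun i j => ∫ y, f i y * g j y ∂μ).det := fun σ => by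
    rw [integral_finsetSum _ fun τ _ => hi σ τ]
    have h1 := Matrix.det_permute σ (Matrix.of fun i j => ∫ y, f i y * g j y ∂μ)
    rw [← Matrix.det_transpose, Matrix.det_apply'] at h1
    have hs : ((Equiv.Perm.sign σ : ℤ) : ℝ) * ((Equiv.Perm.sign σ : ℤ) : ℝ) = 1 := by
      norm_cast
      simp
    calc _ = ((Equiv.Perm.sign σ : ℤ) : ℝ) * ∑ τ : Equiv.Perm (Fin n),
          ((Equiv.Perm.sign τ : ℤ) : ℝ) * ∏ a, ∫ y, f (σ a) y * g (τ a) y ∂μ := by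
          rw [Finset.mul_sum]
          refine Finset.sum_congr rfl fun τ _ => ?_
          rw [integral_const_mul,
            integral_fintype_prod_eq_prod (μ := fun _ => μ) (fun a y => f (σ a) y * g (τ a) y),
            mul_assoc]
      _ = _ := by
          have h2 : ∑ τ : Equiv.Perm (Fin n), ((Equiv.Perm.sign τ : ℤ) : ℝ) *
              ∏ a, ∫ y, f (σ a) y * g (τ a) y ∂μ = ((Equiv.Perm.sign σ : ℤ) : ℝ) *
              (Matrix.of fun i j => ∫ y, f i y * g j y ∂μ).det := h1
          rw [h2, ← mul_assoc, hs, one_mul]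
  rw [Finset.sum_congr rfl fun σ _ => hσ σ]
  simp [Fintype.card_perm]

end Andreief

/-- Adding `c i` times column `i.succ` to column `0` clears it below its top entry, and the
complementary minor is the identity. -/
theorem det_eq_of_col_zero_of_one {m : ℕ} (B : Matrix (Fin (m + 1)) (Fin (m + 1)) ℝ)
    (c : Fin m → ℝ) (h0 : ∀ i : Fin m, B i.succ 0 = -c i)
    (h1 : ∀ i j : Fin m, B i.succ j.succ = if i = j then 1 else 0) :
    B.det = B 0 0 + ∑ i, c i * B 0 i.succ := by
  have h := Matrix.det_updateCol_sum B 0 (Fin.cons 1 c)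
  rw [Fin.cons_zero, one_smul] at h
  rw [← h, Matrix.det_succ_column_zero, Fin.sum_univ_succ, Finset.sum_eq_zero, add_zero]
  · have : (B.updateCol 0 fun k => ∑ i, (Fin.cons 1 c : Fin (m + 1) → ℝ) i • B k i).submatrix
        (Fin.succAbove 0) Fin.succ = 1 := by
      ext i j
      simp [h1, Matrix.one_apply]
    rw [this]
    simp [Fin.sum_univ_succ]
  · intro i _
    simp [Fin.sum_univ_succ, h0, h1]

/-! ### The average of `∏ Λ_a/(Λ_a + z)` over the eigenvalue density. -/

namespace ZFMimo

theorem orthantVolume_eq_pi (n : ℕ) :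
    orthantVolume n = Measure.pi fun _ : Fin n => volume.restrict (Ioi (0 : ℝ)) := by
  rw [← Measure.restrict_pi_pi, orthantVolume]
  congr 1
  ext Λ
  simp

theorem ae_orthantVolume_pos (n : ℕ) : ∀ᵐ Λ ∂(orthantVolume n), ∀ i, 0 < Λ i := by
  have : MeasurableSet {Λ : Fin n → ℝ | ∀ i, 0 < Λ i} := by
    rw [show {Λ : Fin n → ℝ | ∀ i, 0 < Λ i} = univ.pi fun _ => Ioi 0 by ext; simp]
    exact MeasurableSet.univ_pi fun _ => measurableSet_Ioi
  exact ae_restrict_mem this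

section Weight

variable {n : ℕ} {ω : ℝ → ℝ}

theorem IsPolyaWeight.integrable_eigenDensity (h : IsPolyaWeight n ω) :
    Integrable (eigenDensity n (polyaQ ω)) (orthantVolume n) := by
  rw [orthantVolume_eq_pi]
  have := (integrable_det_mul_det (n := n) (μ := volume.restrict (Ioi (0 : ℝ)))
    (f := fun i y => y ^ (i : ℕ)) (g := fun j => polyaQ ω j)
    fun i j => h.integrableOn_pow_mul_polyaQ i.2 j.2).const_mul (1 / (n ! : ℝ))
  refine this.congr (Filter.Eventually.of_forall fun Λ => ?_)
  simp only [eigenDensity, mul_assoc]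
  rfl

open Polynomial in
/-- Monic polynomials `r_i` of degree `i` with `x r_i(x) = (x + z) (p_i(x) - p_i(0))`, `i > 0`. -/
noncomputable def shiftedP (ω : ℝ → ℝ) (z : ℝ) (i : ℕ) : ℝ[X] :=
  if i = 0 then 1 else (X + C z) * (polyaP ω i).divX

theorem IsPolyaWeight.monic_shiftedP (h : IsPolyaWeight n ω) (z : ℝ) {i : ℕ} (hi : i < n) :
    (shiftedP ω z i).Monic ∧ (shiftedP ω z i).natDegree = i := by
  rw [shiftedP]
  split_ifs with h0
  · simp [h0]
  · obtain ⟨h1, h2⟩ := h.monic_polyaP hi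
    have h3 : (polyaP ω i).divX.natDegree = i - 1 := by
      rw [Polynomial.natDegree_divX_eq_natDegree_tsub_one, h2]
    have h4 : (polyaP ω i).divX.Monic := by
      rw [Polynomial.Monic, Polynomial.leadingCoeff, h3, Polynomial.coeff_divX,
        Nat.sub_add_cancel (by omega)]
      rwa [Polynomial.Monic, Polynomial.leadingCoeff, h2] at h1
    refine ⟨(Polynomial.monic_X_add_C z).mul h4, ?_⟩
    rw [(Polynomial.monic_X_add_C z).natDegree_mul h4, h3, Polynomial.natDegree_X_add_C]
    omega

theorem div_add_mul_eval_shiftedP (ω : ℝ → ℝ) {z x : ℝ} (hz : 0 < z) (hx : 0 < x) (i : ℕ) :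
    x / (x + z) * (shiftedP ω z i).eval x =
      if i = 0 then x / (x + z) else (polyaP ω i).eval x - (polyaP ω i).eval 0 := by
  rw [shiftedP]
  split_ifs with h0
  · simp
  · have h1 := congrArg (Polynomial.eval x) (Polynomial.divX_mul_X_add (polyaP ω i))
    rw [Polynomial.eval_add, Polynomial.eval_mul, Polynomial.eval_X, Polynomial.eval_C,
      Polynomial.coeff_zero_eq_eval_zero] at h1
    rw [← h1, Polynomial.eval_mul, Polynomial.eval_add, Polynomial.eval_X, Polynomial.eval_C]
    field_simp
    ring

/-- The Vandermonde determinant is written with the monic polynomials `shiftedP`, and the factor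
`Λ_a/(Λ_a + z)` is absorbed into row `a`. The columns become `x/(x+z)` and `p_i(x) - p_i(0)` for `i
> 0`. In Andréief's matrix biorthonormality then gives the identity outside the first row and
column. Below its top, the first column is `-p_i(0)`, because `p_0 = 1` makes `∫ q_j` equal
`δ_{0j}`. The determinant collects `∑ p_j(0) q_j = K(0, ·)` integrated against `y/(y+z)`. -/
theorem IsPolyaWeight.integral_eigenDensity_mul_prod (h : IsPolyaWeight n ω) (hn : 2 ≤ n)
    {z : ℝ} (hz : 0 < z) :
    ∫ Λ, eigenDensity n (polyaQ ω) Λ * ∏ a, (Λ a / (Λ a + z)) ∂(orthantVolume n) =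
      ∫ y in Ioi (0 : ℝ), y / (y + z) * polyaKernel n ω 0 y := by
  obtain ⟨m, rfl⟩ : ∃ m, n = m + 1 := ⟨n - 1, by omega⟩
  have hb := h.isBiorthonormal.2
  have hq : ∀ j < m + 1, IntegrableOn (polyaQ ω j) (Ioi 0) := fun j hj => by
    simpa using h.integrableOn_pow_mul_polyaQ (a := 0) (by omega) hj
  have htq : ∀ j < m + 1, IntegrableOn (fun y => y / (y + z) * polyaQ ω j y) (Ioi 0) :=
    fun j hj => by simpa using integrableOn_eval_div_add_mul Polynomial.X hz (hq j hj)
  have hP0 : polyaP ω 0 = 1 :=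
    Polynomial.Monic.natDegree_eq_zero (h.monic_polyaP (l := 0) (by omega)).1 |>.1
      (h.monic_polyaP (l := 0) (by omega)).2
  have hq0 : ∀ j < m + 1, ∫ y in Ioi (0 : ℝ), polyaQ ω j y = if 0 = j then 1 else 0 :=
    fun j hj => by simpa [hP0] using (hb 0 (by omega) j hj).2
  set f : Fin (m + 1) → ℝ → ℝ := fun i x =>
    if (i : ℕ) = 0 then x / (x + z) else (polyaP ω i).eval x - (polyaP ω i).eval 0 with hf
  have hf0 : f 0 = fun x => x / (x + z) := by simp [hf]
  have hfs : ∀ i : Fin m, f i.succ =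
      fun x => (polyaP ω (i + 1)).eval x - (polyaP ω (i + 1)).eval 0 := fun i => by simp [hf]
  have hint : ∀ i j : Fin (m + 1), IntegrableOn (fun y => f i y * polyaQ ω j y) (Ioi 0) := by
    intro i j
    refine Fin.cases ?_ (fun i => ?_) i
    · rw [hf0]; exact htq j j.2
    · rw [hfs]
      simp only [sub_mul]
      exact (hb (i + 1) (by omega) j j.2).1.sub ((hq j j.2).const_mul _)
  have hae : ∀ᵐ Λ ∂(orthantVolume (m + 1)),
      eigenDensity (m + 1) (polyaQ ω) Λ * ∏ a, (Λ a / (Λ a + z)) =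
        (1 / ((m + 1)! : ℝ)) * ((Matrix.of fun a i => f i (Λ a)).det *
          (Matrix.of fun a j : Fin (m + 1) => polyaQ ω j (Λ a)).det) := by
    filter_upwards [ae_orthantVolume_pos (m + 1)] with Λ hΛ
    have h1 : (Matrix.of fun a i => f i (Λ a)).det =
        (∏ a, (Λ a / (Λ a + z))) * (Matrix.vandermonde Λ).det := by
      rw [Matrix.det_eval_matrixOfPolynomials_eq_det_vandermonde Λ
        (fun i : Fin (m + 1) => shiftedP ω z i) (fun i => (h.monic_shiftedP z i.2).2)
        (fun i => (h.monic_shiftedP z i.2).1), ← Matrix.det_mul_column]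
      congr 1
      ext a i
      simp only [Matrix.of_apply, hf]
      rw [div_add_mul_eval_shiftedP ω hz (hΛ a)]
    rw [h1, eigenDensity]
    ring
  rw [integral_congr_ae hae, integral_const_mul, orthantVolume_eq_pi,
    integral_det_mul_det (g := fun j : Fin (m + 1) => polyaQ ω j) hint, ← mul_assoc,
    one_div_mul_cancel (by positivity), one_mul,
    det_eq_of_col_zero_of_one _ (fun i : Fin m => (polyaP ω (i + 1)).eval 0)]
  · simp only [Matrix.of_apply, hf0, polyaKernel, kernel, Finset.mul_sum]
    have hi : ∀ j ∈ Finset.range (m + 1), IntegrableOn (fun y => y / (y + z) *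
        ((polyaP ω j).eval 0 * polyaQ ω j y)) (Ioi 0) := fun j hj => by
      simp only [mul_left_comm _ ((polyaP ω j).eval 0)]
      exact (htq j (Finset.mem_range.1 hj)).const_mul _
    rw [integral_finsetSum _ hi, Finset.sum_range_succ', add_comm, Finset.sum_range]
    congr 1
    · refine Finset.sum_congr rfl fun i _ => ?_
      rw [← integral_const_mul]
      refine integral_congr_ae (Filter.Eventually.of_forall fun y => ?_)
      simp only [Fin.val_succ]
      ring
    · simp [hP0]
  all_goals
    intro i
    try intro j
    simp only [Matrix.of_apply, hfs, sub_mul, Fin.val_succ, Fin.val_zero]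
  · rw [integral_sub (hb (i + 1) (by omega) 0 (by omega)).1 ((hq 0 (by omega)).const_mul _),
      integral_const_mul, hq0 0 (by omega), (hb (i + 1) (by omega) 0 (by omega)).2]
    simp
  · rw [integral_sub (hb (i + 1) (by omega) (j + 1) (by omega)).1
      ((hq (j + 1) (by omega)).const_mul _), integral_const_mul, hq0 (j + 1) (by omega),
      (hb (i + 1) (by omega) (j + 1) (by omega)).2]
    simp [Fin.ext_iff]

end Weight

end ZFMimo

/-! ### Haar measure on the unitary group and Gaussian vectors -/

namespace ZFMimo

section Haar

variable {n : ℕ}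

instance matrixSecondCountable {m n : Type*} [Countable m] [Countable n] :
    SecondCountableTopology (Matrix m n ℂ) :=
  inferInstanceAs (SecondCountableTopology (m → n → ℂ))

instance unitaryGroupSecondCountable (n : ℕ) :
    SecondCountableTopology (Matrix.unitaryGroup (Fin n) ℂ) :=
  TopologicalSpace.Subtype.secondCountableTopology _

theorem measurable_matrix_entry {m n : Type*} (i : m) (j : n) :
    Measurable fun A : Matrix m n ℂ => A i j :=
  (measurable_pi_apply j).comp (measurable_pi_apply (X := fun _ : m => n → ℂ) i)

instance isProbabilityMeasure_haarUnitary (n : ℕ) : IsProbabilityMeasure (haarUnitary n) :=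
  ⟨by simpa [haarUnitary] using Measure.haarMeasure_self (G := Matrix.unitaryGroup (Fin n) ℂ) (K₀ := ⊤)⟩

instance isMulLeftInvariant_haarUnitary (n : ℕ) : (haarUnitary n).IsMulLeftInvariant := by
  unfold haarUnitary; infer_instance

/-- A right translate of the Haar measure is again a left-invariant probability measure, so
uniqueness identifies the two. -/
instance isMulRightInvariant_haarUnitary (n : ℕ) : (haarUnitary n).IsMulRightInvariant := by
  refine ⟨fun g => ?_⟩
  have : IsProbabilityMeasure (Measure.map (· * g) (haarUnitary n)) :=
    Measure.isProbabilityMeasure_map (measurable_mul_const g).aemeasurable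
  have h := Measure.haarMeasure_unique (Measure.map (· * g) (haarUnitary n)) ⊤
  rw [TopologicalSpace.PositiveCompacts.coe_top, measure_univ, one_smul] at h
  exact h

/-- `∑ a_i |v_i|²`. -/
noncomputable def weightedNormSq (a : Fin n → ℝ) (v : Fin n → ℂ) : ℝ := ∑ i, a i * ‖v i‖ ^ 2

theorem weightedNormSq_nonneg {a : Fin n → ℝ} (ha : ∀ i, 0 ≤ a i) (v : Fin n → ℂ) :
    0 ≤ weightedNormSq a v :=
  Finset.sum_nonneg fun i _ => mul_nonneg (ha i) (by positivity)

theorem weightedNormSq_smul (a : Fin n → ℝ) (s : ℝ) (v : Fin n → ℂ) :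
    weightedNormSq a ((s : ℂ) • v) = s ^ 2 * weightedNormSq a v := by
  rw [weightedNormSq, weightedNormSq, Finset.mul_sum]
  refine Finset.sum_congr rfl fun i _ => ?_
  rw [Pi.smul_apply, norm_smul, Complex.norm_real, mul_pow, Real.norm_eq_abs, sq_abs]
  ring

theorem ofReal_weightedNormSq_one (v : Fin n → ℂ) :
    ((weightedNormSq 1 v : ℝ) : ℂ) = star v ⬝ᵥ v := by
  simp [weightedNormSq, dotProduct, ← Complex.normSq_eq_conj_mul_self, Complex.sq_norm]

theorem weightedNormSq_one_mulVec (U : Matrix.unitaryGroup (Fin n) ℂ) (v : Fin n → ℂ) :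
    weightedNormSq 1 ((U : Matrix (Fin n) (Fin n) ℂ) *ᵥ v) = weightedNormSq 1 v := by
  have h : star (U : Matrix (Fin n) (Fin n) ℂ) * (U : Matrix (Fin n) (Fin n) ℂ) = 1 :=
    Matrix.UnitaryGroup.star_mul_self U
  rw [← Complex.ofReal_inj, ofReal_weightedNormSq_one, ofReal_weightedNormSq_one,
    Matrix.star_mulVec, ← Matrix.dotProduct_mulVec, Matrix.mulVec_mulVec,
    ← Matrix.star_eq_conjTranspose, h, Matrix.one_mulVec]

theorem weightedNormSq_one_eq_zero {v : Fin n → ℂ} : weightedNormSq 1 v = 0 ↔ v = 0 := by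
  rw [weightedNormSq, Finset.sum_eq_zero_iff_of_nonneg fun i _ => by simp]
  simp [funext_iff]

theorem measurable_weightedNormSq_mulVec (a : Fin n → ℝ) :
    Measurable fun x : Matrix.unitaryGroup (Fin n) ℂ × (Fin n → ℂ) =>
      weightedNormSq a ((x.1 : Matrix (Fin n) (Fin n) ℂ) *ᵥ x.2) := by
  have h : ∀ i j : Fin n, Measurable fun x : Matrix.unitaryGroup (Fin n) ℂ × (Fin n → ℂ) =>
      (x.1 : Matrix (Fin n) (Fin n) ℂ) i j := fun i j =>
    (measurable_matrix_entry i j).comp (measurable_subtype_coe.comp measurable_fst)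
  unfold weightedNormSq
  refine Finset.measurable_sum _ fun i _ => Measurable.const_mul ?_ _
  refine Measurable.pow_const (Measurable.norm ?_) 2
  simp only [Matrix.mulVec, dotProduct]
  exact Finset.measurable_sum _ fun j _ =>
    (h i j).mul ((measurable_pi_apply j).comp measurable_snd)

/-- Extend the unit vector `v` to an orthonormal basis with `v` in position `i₀`; the change of
basis matrix is the required unitary. -/
theorem exists_unitary_mulVec_single (i₀ : Fin n) (v : Fin n → ℂ) (hv : weightedNormSq 1 v = 1) :
    ∃ W : Matrix.unitaryGroup (Fin n) ℂ,
      (W : Matrix (Fin n) (Fin n) ℂ) *ᵥ Pi.single i₀ 1 = v := by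
  have hnorm : ‖WithLp.toLp 2 v‖ = 1 := by
    rw [EuclideanSpace.norm_eq, Real.sqrt_eq_one, ← hv]
    simp [weightedNormSq]
  obtain ⟨b, hb⟩ := Orthonormal.exists_orthonormalBasis_extension_of_card_eq (𝕜 := ℂ)
    (E := EuclideanSpace ℂ (Fin n)) (ι := Fin n) (by simp) (v := fun _ => WithLp.toLp 2 v)
    (s := {i₀}) ⟨fun _ => hnorm, fun i j hij => (hij (Subsingleton.elim i j)).elim⟩
  refine ⟨⟨(EuclideanSpace.basisFun (Fin n) ℂ).toBasis.toMatrix b,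
    (EuclideanSpace.basisFun (Fin n) ℂ).toMatrix_orthonormalBasis_mem_unitary b⟩, ?_⟩
  ext i
  rw [Matrix.mulVec_single_one]
  simp [Module.Basis.toMatrix_apply, Matrix.col, hb i₀ rfl]

/-- Transitivity of the unitary group on spheres, applied to both vectors through a common
coordinate vector. It lets a Haar average at an arbitrary `g` be rewritten as one at the fixed `v`.
-/
theorem exists_unitary_mulVec_eq_smul (v g : Fin n → ℂ) (hv : v ≠ 0) :
    ∃ (W : Matrix.unitaryGroup (Fin n) ℂ) (s : ℝ),
      g = (s : ℂ) • ((W : Matrix (Fin n) (Fin n) ℂ) *ᵥ v) ∧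
        s ^ 2 = weightedNormSq 1 g / weightedNormSq 1 v := by
  by_cases hg : g = 0
  · refine ⟨1, 0, by simp [hg], ?_⟩
    rw [weightedNormSq_one_eq_zero.2 hg]
    simp
  obtain ⟨i₀, -⟩ := Function.ne_iff.1 hv
  have key : ∀ u : Fin n → ℂ, u ≠ 0 → ∃ (W : Matrix.unitaryGroup (Fin n) ℂ) (s : ℝ), 0 < s ∧
      u = (s : ℂ) • ((W : Matrix (Fin n) (Fin n) ℂ) *ᵥ Pi.single i₀ 1) ∧
        s ^ 2 = weightedNormSq 1 u := by
    intro u hu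
    have hpos : 0 < weightedNormSq 1 u :=
      lt_of_le_of_ne (weightedNormSq_nonneg (fun _ => zero_le_one) u)
        fun h => hu (weightedNormSq_one_eq_zero.1 h.symm)
    have hs := Real.sq_sqrt hpos.le
    have hs0 := Real.sqrt_pos.2 hpos
    obtain ⟨W, hW⟩ := exists_unitary_mulVec_single i₀
      ((((Real.sqrt (weightedNormSq 1 u))⁻¹ : ℝ) : ℂ) • u) (by
        rw [weightedNormSq_smul, inv_pow, hs, inv_mul_cancel₀ hpos.ne'])
    refine ⟨W, Real.sqrt (weightedNormSq 1 u), hs0, ?_, hs⟩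
    rw [hW, smul_smul, ← Complex.ofReal_mul, mul_inv_cancel₀ hs0.ne']
    simp
  obtain ⟨W₁, s₁, h₁, e₁, q₁⟩ := key v hv
  obtain ⟨W₂, s₂, h₂, e₂, q₂⟩ := key g hg
  refine ⟨W₂ * W₁⁻¹, s₂ / s₁, ?_, by rw [div_pow, q₁, q₂]⟩
  have hW : ((W₂ * W₁⁻¹ : Matrix.unitaryGroup (Fin n) ℂ) : Matrix (Fin n) (Fin n) ℂ) *
      (W₁ : Matrix (Fin n) (Fin n) ℂ) = W₂ := by
    rw [← Submonoid.coe_mul, inv_mul_cancel_right]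
  conv_rhs => rw [e₁]
  rw [Matrix.mulVec_smul, smul_smul, Matrix.mulVec_mulVec, hW, ← Complex.ofReal_mul,
    div_mul_cancel₀ _ h₁.ne']
  exact e₂

theorem lintegral_exp_neg_weightedNormSq {b : Fin n → ℝ} (hb : ∀ i, 0 < b i) :
    ∫⁻ g : Fin n → ℂ, ENNReal.ofReal (Real.exp (-weightedNormSq b g)) =
      ENNReal.ofReal (∏ i, (Real.pi / b i)) := by
  have h1 : ∀ i, ∫ z : ℂ, Real.exp (-b i * ‖z‖ ^ 2) = Real.pi / b i := fun i => by
    have := GaussianFourier.integral_rexp_neg_mul_sq_norm (V := ℂ) (hb i)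
    rw [this, Complex.finrank_real_complex]
    simp
  have h2 : ∀ i, Integrable fun z : ℂ => Real.exp (-b i * ‖z‖ ^ 2) := fun i => by
    -- The integral of a non-integrable function is `0` by convention, which contradicts the
    -- positive value `π / b i`.
    by_contra hni
    have := h1 i
    rw [integral_undef hni] at this
    have : 0 < Real.pi / b i := div_pos Real.pi_pos (hb i)
    linarith
  have h3 : (fun g : Fin n → ℂ => Real.exp (-weightedNormSq b g)) =
      fun g => ∏ i, Real.exp (-b i * ‖g i‖ ^ 2) := by
    ext g
    rw [← Real.exp_sum, weightedNormSq, ← Finset.sum_neg_distrib]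
    simp only [neg_mul]
  have h4 : Integrable (fun g : Fin n → ℂ => Real.exp (-weightedNormSq b g)) := by
    rw [h3]
    exact Integrable.fintype_prod (f := fun i z => Real.exp (-b i * ‖z‖ ^ 2)) h2
  rw [← ofReal_integral_eq_lintegral_ofReal h4
    (Filter.Eventually.of_forall fun g => (Real.exp_pos _).le), h3,
    integral_fintype_prod_volume_eq_prod fun i (z : ℂ) => Real.exp (-b i * ‖z‖ ^ 2)]
  simp only [h1]

theorem measurable_weightedNormSq (a : Fin n → ℝ) : Measurable (weightedNormSq a) := by
  unfold weightedNormSq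
  fun_prop

/-- The Jacobian is a constant `c`; testing on the Gaussian, which is unitarily invariant and has
finite nonzero integral, forces `c = 1`. -/
theorem lintegral_comp_unitary_mulVec (U : Matrix.unitaryGroup (Fin n) ℂ)
    {F : (Fin n → ℂ) → ENNReal} (hF : Measurable F) :
    ∫⁻ g, F ((U : Matrix (Fin n) (Fin n) ℂ) *ᵥ g) = ∫⁻ g, F g := by
  set T : (Fin n → ℂ) →ₗ[ℝ] (Fin n → ℂ) :=
    (Matrix.mulVecLin (U : Matrix (Fin n) (Fin n) ℂ)).restrictScalars ℝ with hT
  have hTapp : ∀ g, T g = (U : Matrix (Fin n) (Fin n) ℂ) *ᵥ g := fun g => rfl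
  have hinj : Function.Injective T := by
    rw [injective_iff_map_eq_zero]
    intro g hg
    rw [← weightedNormSq_one_eq_zero, ← weightedNormSq_one_mulVec U, ← hTapp, hg]
    simp [weightedNormSq]
  have hdet : LinearMap.det T ≠ 0 := by
    have := (LinearEquiv.ofInjectiveEndo T hinj).isUnit_det'
    exact this.ne_zero
  have hmeas : Measurable T := (T.continuous_of_finiteDimensional).measurable
  have hmap := Measure.map_linearMap_addHaar_eq_smul_addHaar (volume : Measure (Fin n → ℂ)) hdet
  set c := ENNReal.ofReal |(LinearMap.det T)⁻¹|
  have hchange : ∀ G : (Fin n → ℂ) → ENNReal, Measurable G →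
      ∫⁻ g, G ((U : Matrix (Fin n) (Fin n) ℂ) *ᵥ g) = c * ∫⁻ g, G g := fun G hG => by
    rw [← smul_eq_mul, ← lintegral_smul_measure, ← hmap, lintegral_map hG hmeas]
    rfl
  have hc : c = 1 := by
    have h1 := hchange (fun g => ENNReal.ofReal (Real.exp (-weightedNormSq 1 g)))
      (by have := measurable_weightedNormSq (n := n) 1; fun_prop)
    simp only [weightedNormSq_one_mulVec] at h1
    rw [lintegral_exp_neg_weightedNormSq (b := 1) (fun _ => one_pos)] at h1
    have hpos : 0 < ∏ i : Fin n, (Real.pi / (1 : Fin n → ℝ) i) :=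
      Finset.prod_pos fun i _ => by simp [Real.pi_pos]
    refine (ENNReal.mul_left_inj ?_ ENNReal.ofReal_ne_top).1 ((one_mul _).trans h1).symm
    exact (ENNReal.ofReal_pos.2 hpos).ne'
  rw [hchange F hF, hc, one_mul]

/-- Evaluate the double integral of `exp(-|g|² - ∑ a_i |(Ug)_i|²)` over `U` and `g ∈ ℂ^n` in two
orders. Integrating over `g` first, the substitution `g ↦ Ug` gives `∏ π/(1 + a_i)` for every `U`.
Integrating over `U` first, right invariance replaces the direction of `g` by that of `v`. The
exponent becomes `-|g|² (1 + x(U))` with `x(U)` depending on `U` only, and the Gaussian integral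
over `g` produces `(π/(1 + x(U)))^n`. -/
theorem lintegral_haarUnitary_inv_pow {a : Fin n → ℝ} (ha : ∀ i, 0 ≤ a i) {v : Fin n → ℂ}
    (hv : v ≠ 0) :
    ∫⁻ U, ENNReal.ofReal ((1 + weightedNormSq a ((U : Matrix (Fin n) (Fin n) ℂ) *ᵥ v) /
        weightedNormSq 1 v)⁻¹ ^ n) ∂(haarUnitary n) =
      ENNReal.ofReal (∏ i, (1 + a i)⁻¹) := by
  set E : (Fin n → ℝ) → (Fin n → ℂ) → ENNReal :=
    fun b g => ENNReal.ofReal (Real.exp (-weightedNormSq b g)) with hE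
  have hEm : ∀ b, Measurable (E b) := fun b => by
    have := measurable_weightedNormSq b
    simp only [hE]
    fun_prop
  set F : Matrix.unitaryGroup (Fin n) ℂ → (Fin n → ℂ) → ENNReal :=
    fun U g => ENNReal.ofReal (Real.exp (-(weightedNormSq 1 g +
      weightedNormSq a ((U : Matrix (Fin n) (Fin n) ℂ) *ᵥ g)))) with hF
  have hFm : Measurable (Function.uncurry F) := by
    have h1 := measurable_weightedNormSq_mulVec a
    have h2 : Measurable fun p : Matrix.unitaryGroup (Fin n) ℂ × (Fin n → ℂ) =>
        weightedNormSq 1 p.2 := (measurable_weightedNormSq 1).comp measurable_snd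
    exact (Real.measurable_exp.comp (h2.add h1).neg).ennreal_ofReal
  have hpi : ENNReal.ofReal (Real.pi ^ n) ≠ 0 := (ENNReal.ofReal_pos.2 (by positivity)).ne'
  -- integration over `g` first
  have hleft : ∫⁻ U, ∫⁻ g, F U g ∂volume ∂(haarUnitary n) =
      ENNReal.ofReal (∏ i, (1 + a i)⁻¹) * ENNReal.ofReal (Real.pi ^ n) := by
    have h1 : ∀ U : Matrix.unitaryGroup (Fin n) ℂ, ∫⁻ g, F U g =
        ENNReal.ofReal (∏ i, (1 + a i)⁻¹) * ENNReal.ofReal (Real.pi ^ n) := fun U => by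
      have h2 : ∀ g, F U g = E (1 + a) ((U : Matrix (Fin n) (Fin n) ℂ) *ᵥ g) := fun g => by
        simp only [hF, hE]
        rw [← weightedNormSq_one_mulVec U g]
        simp [weightedNormSq, add_mul, Finset.sum_add_distrib]
      simp only [h2]
      rw [lintegral_comp_unitary_mulVec U (hEm _), hE]
      simp only
      rw [lintegral_exp_neg_weightedNormSq fun i => by
          have := ha i; simp only [Pi.add_apply, Pi.one_apply]; positivity,
        ← ENNReal.ofReal_mul (Finset.prod_nonneg fun i _ => by have := ha i; positivity)]
      congr 1
      simp only [Pi.add_apply, Pi.one_apply, div_eq_inv_mul, Finset.prod_mul_distrib,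
        Finset.prod_const, Finset.card_univ, Fintype.card_fin]
    simp [h1]
  -- integration over `U` first
  set x : Matrix.unitaryGroup (Fin n) ℂ → ℝ := fun U =>
    weightedNormSq a ((U : Matrix (Fin n) (Fin n) ℂ) *ᵥ v) / weightedNormSq 1 v with hx
  have hx0 : ∀ U, 0 ≤ x U := fun U => div_nonneg (weightedNormSq_nonneg ha _)
    (weightedNormSq_nonneg (fun _ => zero_le_one) _)
  set F' : Matrix.unitaryGroup (Fin n) ℂ → (Fin n → ℂ) → ENNReal :=
    fun U g => E (fun _ => 1 + x U) g with hF'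
  have hF'eq : ∀ U g, F' U g =
      ENNReal.ofReal (Real.exp (-(weightedNormSq 1 g * (1 + x U)))) := fun U g => by
    simp [hF', hE, weightedNormSq, Finset.sum_mul, mul_comm]
  have hxm : Measurable x :=
    ((measurable_weightedNormSq_mulVec a).comp (measurable_id.prodMk measurable_const)).div_const _
  have hF'm : Measurable (Function.uncurry F') := by
    have h2 : Measurable fun p : Matrix.unitaryGroup (Fin n) ℂ × (Fin n → ℂ) =>
        weightedNormSq 1 p.2 := (measurable_weightedNormSq 1).comp measurable_snd
    have h3 : Function.uncurry F' = fun p : Matrix.unitaryGroup (Fin n) ℂ × (Fin n → ℂ) =>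
        ENNReal.ofReal (Real.exp (-(weightedNormSq 1 p.2 * (1 + x p.1)))) := by
      ext p; exact hF'eq p.1 p.2
    rw [h3]
    exact (Real.measurable_exp.comp
      (h2.mul ((hxm.comp measurable_fst).const_add 1)).neg).ennreal_ofReal
  have hswap : ∀ g, ∫⁻ U, F U g ∂(haarUnitary n) = ∫⁻ U, F' U g ∂(haarUnitary n) := fun g => by
    obtain ⟨W, s, hg, hs⟩ := exists_unitary_mulVec_eq_smul v g hv
    rw [← lintegral_mul_right_eq_self (fun U => F' U g) W]
    refine lintegral_congr fun U => ?_
    rw [hF'eq]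
    simp only [hF, hx]
    congr 3
    have h1 : (U : Matrix (Fin n) (Fin n) ℂ) *ᵥ g = (s : ℂ) •
        (((U * W : Matrix.unitaryGroup (Fin n) ℂ) : Matrix (Fin n) (Fin n) ℂ) *ᵥ v) := by
      rw [Submonoid.coe_mul, ← Matrix.mulVec_mulVec, ← Matrix.mulVec_smul, ← hg]
    rw [h1, weightedNormSq_smul, hs]
    ring
  have hright : ∫⁻ U, ∫⁻ g, F' U g ∂volume ∂(haarUnitary n) =
      (∫⁻ U, ENNReal.ofReal ((1 + x U)⁻¹ ^ n) ∂(haarUnitary n)) *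
        ENNReal.ofReal (Real.pi ^ n) := by
    rw [← lintegral_mul_const' _ _ ENNReal.ofReal_ne_top]
    refine lintegral_congr fun U => ?_
    have := hx0 U
    simp only [hF', hE]
    rw [lintegral_exp_neg_weightedNormSq fun i => by positivity,
      ← ENNReal.ofReal_mul (by positivity)]
    simp [div_eq_inv_mul, mul_pow]
  refine (ENNReal.mul_left_inj hpi ENNReal.ofReal_ne_top).1 ?_
  rw [← hleft, ← hright, lintegral_lintegral_swap hFm.aemeasurable,
    lintegral_lintegral_swap hF'm.aemeasurable]
  exact lintegral_congr fun g => (hswap g).symm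

end Haar

end ZFMimo

/-! ### Measures on the half-line determined by generalized Stieltjes transforms -/

section Determinacy

/-- The exponential series may be integrated termwise because the moments are bounded by the total
mass. Therefore the moments determine the characteristic function, hence the measure. -/
theorem hasSum_charFun_of_ae_abs_le_one (ρ : Measure ℝ) [IsFiniteMeasure ρ]
    (h : ∀ᵐ x ∂ρ, |x| ≤ 1) (t : ℝ) :
    HasSum (fun k : ℕ => ((t : ℂ) * Complex.I) ^ k / (k ! : ℂ) * ((∫ x, x ^ k ∂ρ : ℝ) : ℂ))
      (charFun ρ t) := by
  set F : ℕ → ℝ → ℂ := fun k x => ((t : ℂ) * Complex.I) ^ k / (k ! : ℂ) * ((x ^ k : ℝ) : ℂ)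
    with hF
  have hFi : ∀ k, Integrable (F k) ρ := fun k => by
    refine Integrable.const_mul (Integrable.ofReal (f := fun x : ℝ => x ^ k) ?_) _
    refine (integrable_const (1 : ℝ)).mono' (by fun_prop) ?_
    filter_upwards [h] with x hx
    rw [norm_pow, Real.norm_eq_abs]
    exact pow_le_one₀ (abs_nonneg x) hx
  have hsum : Summable fun k => ∫ x, ‖F k x‖ ∂ρ := by
    refine Summable.of_nonneg_of_le (fun k => integral_nonneg fun x => norm_nonneg _)
      (fun k => ?_) ((Real.summable_pow_div_factorial |t|).mul_right (ρ.real univ))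
    calc ∫ x, ‖F k x‖ ∂ρ ≤ ∫ _, |t| ^ k / (k ! : ℝ) ∂ρ := by
          refine integral_mono_ae (hFi k).norm (integrable_const _) ?_
          filter_upwards [h] with x hx
          simp only [hF, norm_mul, norm_div, norm_pow, Complex.norm_I, mul_one,
            Complex.norm_real, Complex.norm_natCast, Real.norm_eq_abs]
          exact mul_le_of_le_one_right (by positivity) (by simpa using pow_le_one₀ (abs_nonneg x) hx)
      _ = |t| ^ k / (k ! : ℝ) * ρ.real univ := by
          rw [integral_const, smul_eq_mul, mul_comm]
  have := hasSum_integral_of_summable_integral_norm hFi hsum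
  rw [charFun_apply_real]
  have hexp : ∀ x : ℝ, ∑' k, F k x = Complex.exp (t * x * Complex.I) := fun x => by
    rw [Complex.exp_eq_exp_ℂ, ← (NormedSpace.expSeries_div_hasSum_exp
      ((t : ℂ) * x * Complex.I)).tsum_eq]
    refine tsum_congr fun k => ?_
    simp only [hF, Complex.ofReal_pow, mul_pow]
    ring
  have hk : ∀ k, ∫ x, F k x ∂ρ =
      ((t : ℂ) * Complex.I) ^ k / (k ! : ℂ) * ((∫ x, x ^ k ∂ρ : ℝ) : ℂ) := fun k => by
    rw [← integral_complex_ofReal, ← integral_const_mul]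
  simp only [hexp, hk] at this
  exact this

theorem Measure.ext_of_integral_pow_of_ae_abs_le_one {ρ₁ ρ₂ : Measure ℝ} [IsFiniteMeasure ρ₁]
    [IsFiniteMeasure ρ₂] (h₁ : ∀ᵐ x ∂ρ₁, |x| ≤ 1) (h₂ : ∀ᵐ x ∂ρ₂, |x| ≤ 1)
    (h : ∀ k : ℕ, ∫ x, x ^ k ∂ρ₁ = ∫ x, x ^ k ∂ρ₂) : ρ₁ = ρ₂ := by
  refine Measure.ext_of_charFun (funext fun t => ?_)
  have e₁ := hasSum_charFun_of_ae_abs_le_one ρ₁ h₁ t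
  simp only [h] at e₁
  exact e₁.unique (hasSum_charFun_of_ae_abs_le_one ρ₂ h₂ t)

theorem pow_div_add_pow_le {y z c : ℝ} (hy : 0 < y) (hc : 0 < c) (hz : c ≤ z) (n m : ℕ) :
    y ^ n / (y + z) ^ (n + m) ≤ (c⁻¹) ^ m := by
  have hz0 : 0 < z := hc.trans_le hz
  rw [inv_pow, ← one_div, div_le_div_iff₀ (by positivity) (by positivity), one_mul, pow_add]
  exact mul_le_mul (pow_le_pow_left₀ hy.le (by linarith) n)
    (pow_le_pow_left₀ hc.le (by linarith) m) (by positivity) (by positivity)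

/-- Differentiation under the integral sign; keeping the parameter above `z/2` provides a bound
independent of `y`. -/
theorem hasDerivAt_integral_pow_div_add_pow (ν : Measure ℝ) [IsFiniteMeasure ν]
    (hν : ∀ᵐ y ∂ν, 0 < y) (n m : ℕ) {z : ℝ} (hz : 0 < z) :
    HasDerivAt (fun z => ∫ y, y ^ n / (y + z) ^ (n + m) ∂ν)
      (-((n + m : ℕ) : ℝ) * ∫ y, y ^ n / (y + z) ^ (n + (m + 1)) ∂ν) z := by
  rw [← integral_const_mul]
  refine (hasDerivAt_integral_of_dominated_loc_of_deriv_le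
    (F' := fun z y => -((n + m : ℕ) : ℝ) * (y ^ n / (y + z) ^ (n + (m + 1))))
    (bound := fun _ => ((n + m : ℕ) : ℝ) * ((z / 2)⁻¹) ^ (m + 1))
    (s := Ioi (z / 2)) (Ioi_mem_nhds (by linarith)) ?_ ?_ ?_ ?_ (integrable_const _) ?_).2
  · exact Filter.Eventually.of_forall fun w => Measurable.aestronglyMeasurable (by fun_prop)
  · refine (integrable_const ((z⁻¹) ^ m)).mono' (Measurable.aestronglyMeasurable (by fun_prop)) ?_
    filter_upwards [hν] with y hy
    rw [Real.norm_of_nonneg (by positivity)]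
    exact pow_div_add_pow_le hy hz le_rfl n m
  · exact Measurable.aestronglyMeasurable (by fun_prop)
  · filter_upwards [hν] with y hy w hw
    have hw : z / 2 < w := hw
    have : 0 < w := by linarith
    rw [norm_mul, norm_neg, Real.norm_of_nonneg (by positivity), Real.norm_of_nonneg (by positivity)]
    exact mul_le_mul_of_nonneg_left (pow_div_add_pow_le hy (by linarith) hw.le n (m + 1))
      (by positivity)
  · filter_upwards [hν] with y hy w hw
    have hw : z / 2 < w := hw
    have hw0 : 0 < w := by linarith
    have h1 : HasDerivAt (fun w => (y + w) ^ (n + m)) (((n + m : ℕ) : ℝ) * (y + w) ^ (n + m - 1)) w := by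
      simpa using ((hasDerivAt_id' w).const_add y).fun_pow (n + m)
    have h2 := (hasDerivAt_const w (y ^ n)).fun_div h1 (by positivity)
    refine h2.congr_deriv ?_
    rcases Nat.eq_zero_or_pos (n + m) with h0 | h0
    · simp [h0]
    · obtain ⟨k, hk⟩ : ∃ k, n + m = k + 1 := ⟨n + m - 1, by omega⟩
      rw [← add_assoc n m 1, hk]
      simp only [Nat.add_sub_cancel]
      field_simp
      ring

theorem integral_pow_div_add_pow_eq {ν₁ ν₂ : Measure ℝ} [IsFiniteMeasure ν₁] [IsFiniteMeasure ν₂]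
    (h₁ : ∀ᵐ y ∂ν₁, 0 < y) (h₂ : ∀ᵐ y ∂ν₂, 0 < y) {n : ℕ} (hn : 0 < n)
    (h : ∀ z, 0 < z → ∫ y, (y / (y + z)) ^ n ∂ν₁ = ∫ y, (y / (y + z)) ^ n ∂ν₂) (m : ℕ) :
    ∀ z, 0 < z → ∫ y, y ^ n / (y + z) ^ (n + m) ∂ν₁ = ∫ y, y ^ n / (y + z) ^ (n + m) ∂ν₂ := by
  induction m with
  | zero => simpa [div_pow] using h
  | succ m ih =>
    intro z hz
    have e₁ := hasDerivAt_integral_pow_div_add_pow ν₁ h₁ n m hz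
    have e₂ := hasDerivAt_integral_pow_div_add_pow ν₂ h₂ n m hz
    have heq : (fun z => ∫ y, y ^ n / (y + z) ^ (n + m) ∂ν₁) =ᶠ[nhds z]
        fun z => ∫ y, y ^ n / (y + z) ^ (n + m) ∂ν₂ := by
      filter_upwards [Ioi_mem_nhds hz] with w hw using ih w hw
    have h3 := (e₂.congr_of_eventuallyEq heq).unique e₁
    -- The derivative carries the factor `n + m`, nonzero because `n > 0`.
    refine (mul_left_cancel₀ ?_ h3).symm
    rw [neg_ne_zero]
    positivity

/-- Repeated differentiation in `z` at `z = 1` yields the integrals of `(y/(y+1))^n (y+1)^(-k)` for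
all `k`. These are the moments of the image of `(y/(y+1))^n ν` under `y ↦ 1/(y+1)`, a measure
supported in `[-1, 1]`. It is therefore determined, and both the map and the positive weight can be
inverted. -/
theorem Measure.ext_of_integral_div_add_pow {ν₁ ν₂ : Measure ℝ} [IsFiniteMeasure ν₁]
    [IsFiniteMeasure ν₂] (h₁ : ∀ᵐ y ∂ν₁, 0 < y) (h₂ : ∀ᵐ y ∂ν₂, 0 < y) {n : ℕ} (hn : 0 < n)
    (h : ∀ z, 0 < z → ∫ y, (y / (y + z)) ^ n ∂ν₁ = ∫ y, (y / (y + z)) ^ n ∂ν₂) : ν₁ = ν₂ := by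
  set w : ℝ → ENNReal := fun y => ENNReal.ofReal ((y / (y + 1)) ^ n) with hw
  have hwm : Measurable w := by fun_prop
  set t : ℝ → ℝ := fun y => (y + 1)⁻¹ with ht
  have htm : Measurable t := by fun_prop
  have hsm : Measurable fun x : ℝ => x⁻¹ - 1 := by fun_prop
  set ρ : Measure ℝ → Measure ℝ := fun ν => (ν.withDensity w).map t with hρ
  have hpos : ∀ ν : Measure ℝ, (∀ᵐ y ∂ν, 0 < y) → ∀ᵐ y ∂(ν.withDensity w), 0 < y := fun ν hν =>
    (withDensity_absolutelyContinuous ν w).ae_le hν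
  have hfin : ∀ ν : Measure ℝ, IsFiniteMeasure ν → (∀ᵐ y ∂ν, 0 < y) →
      IsFiniteMeasure (ν.withDensity w) := fun ν _ hν => by
    refine isFiniteMeasure_withDensity_ofReal
      (Integrable.mono' (integrable_const (1 : ℝ))
        (Measurable.aestronglyMeasurable (by fun_prop)) ?_).2
    filter_upwards [hν] with y hy
    have := div_add_mem_Icc hy one_pos
    rw [Real.norm_of_nonneg (by positivity)]
    exact pow_le_one₀ this.1 this.2
  have hbd : ∀ ν : Measure ℝ, (∀ᵐ y ∂ν, 0 < y) → ∀ᵐ x ∂(ρ ν), |x| ≤ 1 := fun ν hν => by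
    rw [hρ, ae_map_iff htm.aemeasurable (measurableSet_le (by fun_prop) (by fun_prop))]
    filter_upwards [hpos ν hν] with y hy
    rw [abs_of_pos (by positivity)]
    exact inv_le_one_of_one_le₀ (by linarith)
  have hmom : ∀ ν : Measure ℝ, (∀ᵐ y ∂ν, 0 < y) → ∀ k : ℕ,
      ∫ x, x ^ k ∂(ρ ν) = ∫ y, y ^ n / (y + 1) ^ (n + k) ∂ν := fun ν hν k => by
    rw [hρ, integral_map htm.aemeasurable (by fun_prop),
      integral_withDensity_eq_integral_toReal_smul hwm (by simp [hw])]
    refine integral_congr_ae ?_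
    filter_upwards [hν] with y hy
    simp only [hw, ht]
    rw [ENNReal.toReal_ofReal (by positivity), smul_eq_mul, div_pow, inv_pow, pow_add]
    field_simp
  have := hfin ν₁ ‹_› h₁
  have := hfin ν₂ ‹_› h₂
  have hρeq : ρ ν₁ = ρ ν₂ := by
    have : IsFiniteMeasure (ρ ν₁) := Measure.isFiniteMeasure_map _ _
    have : IsFiniteMeasure (ρ ν₂) := Measure.isFiniteMeasure_map _ _
    refine _root_.Measure.ext_of_integral_pow_of_ae_abs_le_one (hbd ν₁ h₁) (hbd ν₂ h₂) fun k => ?_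
    rw [hmom ν₁ h₁, hmom ν₂ h₂]
    exact integral_pow_div_add_pow_eq h₁ h₂ hn h k 1 one_pos
  have hback : ∀ ν : Measure ℝ, (∀ᵐ y ∂ν, 0 < y) →
      ((ρ ν).map fun x => x⁻¹ - 1).withDensity (fun y => (w y)⁻¹) = ν := fun ν hν => by
    have hcomp : (fun x : ℝ => x⁻¹ - 1) ∘ t = id := by
      ext y; simp [ht]
    rw [hρ, Measure.map_map hsm htm, hcomp, Measure.map_id]
    refine withDensity_inv_same hwm ?_ (by simp [hw])
    filter_upwards [hν] with y hy
    exact (ENNReal.ofReal_pos.2 (by positivity)).ne'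
  rw [← hback ν₁ h₁, ← hback ν₂ h₂, hρeq]

end Determinacy

/-! ### Identification of a density -/

section Determinacy

theorem integrable_div_add_pow (ν : Measure ℝ) [IsFiniteMeasure ν] (hν : ∀ᵐ y ∂ν, 0 < y) (n : ℕ)
    {z : ℝ} (hz : 0 < z) : Integrable (fun y => (y / (y + z)) ^ n) ν := by
  refine Integrable.mono' (integrable_const (1 : ℝ)) (Measurable.aestronglyMeasurable
    (by fun_prop)) ?_
  filter_upwards [hν] with y hy
  have := ZFMimo.div_add_mem_Icc hy hz
  rw [Real.norm_of_nonneg (by positivity)]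
  exact pow_le_one₀ this.1 this.2

/-- As `ρ` may a priori change sign, its negative part is moved to the other side: `ν + ρ₋ = ρ₊` is
an identity of finite positive measures. On the open set `ρ < 0` the measure `ρ₊` vanishes, hence so
does `ρ₋`, and the set is Lebesgue null. An open null set is empty, so `ρ ≥ 0` at every point and
`ρ₋ = 0`. -/
theorem eq_withDensity_of_integral_div_add_pow {ν : Measure ℝ} [IsFiniteMeasure ν]
    (hν : ∀ᵐ y ∂ν, 0 < y) {ρ : ℝ → ℝ} (hc : ContinuousOn ρ (Ioi 0))
    (hi : IntegrableOn ρ (Ioi 0)) {n : ℕ} (hn : 0 < n)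
    (h : ∀ z, 0 < z → ∫ y, (y / (y + z)) ^ n ∂ν =
      ∫ y in Ioi (0 : ℝ), (y / (y + z)) ^ n * ρ y) :
    (∀ y, 0 < y → 0 ≤ ρ y) ∧
      ν = (volume.restrict (Ioi 0)).withDensity fun y => ENNReal.ofReal (ρ y) := by
  set m : (ℝ → ℝ) → Measure ℝ :=
    fun f => (volume.restrict (Ioi 0)).withDensity fun y => ENNReal.ofReal (f y) with hm
  have hρm : AEMeasurable ρ (volume.restrict (Ioi 0)) := hi.aestronglyMeasurable.aemeasurable
  have hρm' : AEMeasurable (fun y => -ρ y) (volume.restrict (Ioi 0)) := hρm.neg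
  have hi' : IntegrableOn (fun y => -ρ y) (Ioi 0) := hi.neg
  have hfin : ∀ f : ℝ → ℝ, IntegrableOn f (Ioi 0) → IsFiniteMeasure (m f) := fun f hf =>
    isFiniteMeasure_withDensity_ofReal hf.2
  have hpos : ∀ f : ℝ → ℝ, ∀ᵐ y ∂(m f), 0 < y := fun f =>
    (withDensity_absolutelyContinuous _ _).ae_le (ae_restrict_mem measurableSet_Ioi)
  have hint : ∀ f : ℝ → ℝ, AEMeasurable f (volume.restrict (Ioi 0)) → ∀ z,
      ∫ y, (y / (y + z)) ^ n ∂(m f) = ∫ y in Ioi (0 : ℝ), (y / (y + z)) ^ n * max (f y) 0 :=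
    fun f hf z => by
      rw [hm, integral_withDensity_eq_integral_toReal_smul₀ hf.ennreal_ofReal
        (Filter.Eventually.of_forall fun _ => ENNReal.ofReal_lt_top)]
      simp only [ENNReal.toReal_ofReal', smul_eq_mul, mul_comm]
  have := hfin ρ hi
  have := hfin (fun y => -ρ y) hi'
  have key : ν + m (fun y => -ρ y) = m ρ := by
    refine _root_.Measure.ext_of_integral_div_add_pow ?_ (hpos ρ) hn fun z hz => ?_
    · rw [ae_add_measure_iff]
      exact ⟨hν, hpos _⟩
    · have hb : ∀ f : ℝ → ℝ, IntegrableOn f (Ioi 0) →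
          IntegrableOn (fun y => (y / (y + z)) ^ n * max (f y) 0) (Ioi 0) := fun f hf => by
        simpa using ZFMimo.integrableOn_eval_div_add_mul (Polynomial.X ^ n) hz hf.pos_part
      rw [integral_add_measure (integrable_div_add_pow ν hν n hz)
        (integrable_div_add_pow _ (hpos _) n hz), h z hz, hint ρ hρm,
        hint (fun y => -ρ y) hρm', ← integral_add _ (hb _ hi')]
      · refine integral_congr_ae (Filter.Eventually.of_forall fun y => ?_)
        simp only [← mul_add]
        congr 1
        rcases le_total (ρ y) 0 with h0 | h0
        · rw [max_eq_left (by linarith), max_eq_right h0]; ring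
        · rw [max_eq_right (by linarith), max_eq_left h0]; ring
      · have h1 := ZFMimo.integrableOn_eval_div_add_mul (Polynomial.X ^ n) hz hi
        simp only [Polynomial.eval_pow, Polynomial.eval_X] at h1
        exact h1
  have hs : IsOpen (Ioi 0 ∩ ρ ⁻¹' Iio 0) := hc.isOpen_inter_preimage isOpen_Ioi isOpen_Iio
  set s := Ioi 0 ∩ ρ ⁻¹' Iio 0 with hsdef
  have hplus : m ρ s = 0 := by
    rw [hm, withDensity_apply _ hs.measurableSet]
    rw [setLIntegral_congr_fun (g := fun _ => 0) hs.measurableSet fun y hy => ?_]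
    · simp
    · exact ENNReal.ofReal_of_nonpos (le_of_lt hy.2)
  have hminus : m (fun y => -ρ y) s = 0 := by
    refine nonpos_iff_eq_zero.1 ?_
    rw [← hplus, ← key, Measure.add_apply]
    exact le_add_self
  have hempty : s = ∅ := by
    rw [← hs.measure_eq_zero_iff volume]
    rw [hm, withDensity_apply _ hs.measurableSet, Measure.restrict_restrict hs.measurableSet,
      inter_eq_left.2 inter_subset_left,
      lintegral_eq_zero_iff' (hρm'.mono_measure (Measure.restrict_mono
        inter_subset_left le_rfl)).ennreal_ofReal] at hminus
    rw [← Measure.restrict_apply_self]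
    refine measure_mono_null (fun y hy => ?_)
      (ae_iff.1 (hminus.and (ae_restrict_mem hs.measurableSet)))
    simp only [mem_ofPred_eq, Pi.zero_apply, ENNReal.ofReal_eq_zero]
    intro hcon
    have h1 : ρ y < 0 := hy.2
    linarith [hcon.1]
  have hnonneg : ∀ y, 0 < y → 0 ≤ ρ y := fun y hy => by
    by_contra hlt
    have : y ∈ s := ⟨hy, not_le.1 hlt⟩
    rw [hempty] at this
    exact this
  refine ⟨hnonneg, ?_⟩
  have hzero : m (fun y => -ρ y) = 0 := by
    simp only [hm]
    rw [withDensity_eq_zero_iff hρm'.ennreal_ofReal]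
    filter_upwards [ae_restrict_mem measurableSet_Ioi] with y hy
    exact ENNReal.ofReal_of_nonpos (by linarith [hnonneg y hy])
  rw [hzero, add_zero] at key
  exact key

end Determinacy

namespace ZFMimo

/-! ### The SINR as a function of the Gram matrix -/

section Gram

variable {n : ℕ} {S : Matrix (Fin n) (Fin n) ℂ}

theorem conjTranspose_sqrt (S : Matrix (Fin n) (Fin n) ℂ) : (CFC.sqrt S)ᴴ = CFC.sqrt S :=
  (CFC.sqrt_nonneg S).isSelfAdjoint

theorem isUnit_det_sqrt (hS : S.PosDef) : IsUnit (CFC.sqrt S).det := by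
  have h : CFC.sqrt S * CFC.sqrt S = S := CFC.sqrt_mul_sqrt_self S hS.posSemidef.nonneg
  have h2 : IsUnit S.det := (Matrix.isUnit_iff_isUnit_det S).1 hS.isUnit
  rw [← h, Matrix.det_mul] at h2
  exact isUnit_of_mul_isUnit_left h2

/-- The `k`-th column of `(√S)⁻¹`. -/
noncomputable def invSqrtCol (S : Matrix (Fin n) (Fin n) ℂ) (k : Fin n) : Fin n → ℂ :=
  fun j => (CFC.sqrt S)⁻¹ j k

theorem conjTranspose_mul_diagonal_mul_apply_self (B : Matrix (Fin n) (Fin n) ℂ) (d : Fin n → ℝ)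
    (k : Fin n) : (Bᴴ * Matrix.diagonal (fun i => (d i : ℂ)) * B) k k =
      ((weightedNormSq d fun i => B i k : ℝ) : ℂ) := by
  rw [Matrix.mul_apply, weightedNormSq, Complex.ofReal_sum]
  refine Finset.sum_congr rfl fun i _ => ?_
  rw [Matrix.mul_diagonal, Matrix.conjTranspose_apply, mul_right_comm, RCLike.star_def, ← Complex.normSq_eq_conj_mul_self, Complex.sq_norm]
  push_cast
  ring

theorem invDiag_eq_weightedNormSq (hS : S.PosDef) (k : Fin n) :
    invDiag S k = weightedNormSq 1 (invSqrtCol S k) := by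
  have h : CFC.sqrt S * CFC.sqrt S = S := CFC.sqrt_mul_sqrt_self S hS.posSemidef.nonneg
  have h1 : S⁻¹ = ((CFC.sqrt S)⁻¹)ᴴ * Matrix.diagonal (fun _ => ((1 : ℝ) : ℂ)) *
      (CFC.sqrt S)⁻¹ := by
    rw [Matrix.conjTranspose_nonsing_inv, conjTranspose_sqrt, Complex.ofReal_one,
      Matrix.diagonal_one, mul_one, ← Matrix.mul_inv_rev, h]
  rw [invDiag, h1, conjTranspose_mul_diagonal_mul_apply_self (d := fun _ => 1), Complex.ofReal_re]
  rfl

theorem invDiag_pos (hS : S.PosDef) (k : Fin n) : 0 < invDiag S k := by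
  have h : (0 : ℂ) < S⁻¹ k k := hS.inv.diag_pos
  exact (Complex.pos_iff.1 h).1

theorem invSqrtCol_ne_zero (hS : S.PosDef) (k : Fin n) : invSqrtCol S k ≠ 0 := fun h => by
  have := invDiag_pos hS k
  rw [invDiag_eq_weightedNormSq hS, weightedNormSq_one_eq_zero.2 h] at this
  exact lt_irrefl _ this

/-- The SINR `γ_k` of the channel `P √S` as a function of `A = P† P`. -/
noncomputable def gramSINR (δ : ℝ) (S : Matrix (Fin n) (Fin n) ℂ) (k : Fin n)
    (A : Matrix (Fin n) (Fin n) ℂ) : ℝ :=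
  δ / (((CFC.sqrt S)ᴴ * A * CFC.sqrt S)⁻¹ k k).re

theorem zfSINR_channel {nr : ℕ} (δ : ℝ) (P : Matrix (Fin nr) (Fin n) ℂ)
    (S : Matrix (Fin n) (Fin n) ℂ) (k : Fin n) :
    zfSINR δ (channel P S) k = gramSINR δ S k (Pᴴ * P) := by
  simp only [zfSINR, channel, gramSINR, Matrix.conjTranspose_mul, Matrix.mul_assoc]

theorem measurable_gramSINR (δ : ℝ) (S : Matrix (Fin n) (Fin n) ℂ) (k : Fin n) :
    Measurable (gramSINR δ S k) := by
  have h1 : Continuous fun A : Matrix (Fin n) (Fin n) ℂ => (CFC.sqrt S)ᴴ * A * CFC.sqrt S := by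
    fun_prop
  have h2 : Measurable fun A : Matrix (Fin n) (Fin n) ℂ =>
      ((CFC.sqrt S)ᴴ * A * CFC.sqrt S).det := h1.matrix_det.measurable
  have h3 : Measurable fun A : Matrix (Fin n) (Fin n) ℂ =>
      ((CFC.sqrt S)ᴴ * A * CFC.sqrt S).adjugate k k :=
    (h1.matrix_adjugate.matrix_elem k k).measurable
  unfold gramSINR
  simp only [Matrix.inv_def, Ring.inverse_eq_inv', Matrix.smul_apply, smul_eq_mul]
  exact measurable_const.div (Complex.measurable_re.comp (h2.inv.mul h3))

/-- The inverse of `√S U†ΛU √S` is `(U (√S)⁻¹)† Λ⁻¹ (U (√S)⁻¹)`, whose diagonal entry is a quadratic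
form in the `k`-th column of `(√S)⁻¹`. -/
theorem gramSINR_conj (hS : S.PosDef) (δ : ℝ) (k : Fin n)
    (U : Matrix.unitaryGroup (Fin n) ℂ) {Λ : Fin n → ℝ} (hΛ : ∀ i, 0 < Λ i) :
    gramSINR δ S k ((U : Matrix (Fin n) (Fin n) ℂ)ᴴ * Matrix.diagonal (fun i => (Λ i : ℂ)) *
      (U : Matrix (Fin n) (Fin n) ℂ)) =
      δ / weightedNormSq (fun i => (Λ i)⁻¹)
        ((U : Matrix (Fin n) (Fin n) ℂ) *ᵥ invSqrtCol S k) := by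
  set T := CFC.sqrt S with hT
  have hTu : IsUnit T.det := isUnit_det_sqrt hS
  have hTT : T⁻¹ * T = 1 := Matrix.nonsing_inv_mul T hTu
  have hTH : Tᴴ = T := conjTranspose_sqrt S
  set V := (U : Matrix (Fin n) (Fin n) ℂ) with hV
  have hVV : V * Vᴴ = 1 := Matrix.mem_unitaryGroup_iff.1 U.2
  have hVV' : Vᴴ * V = 1 := Matrix.mem_unitaryGroup_iff'.1 U.2
  have hDD : Matrix.diagonal (fun i => (((Λ i)⁻¹ : ℝ) : ℂ)) *
      Matrix.diagonal (fun i => (Λ i : ℂ)) = 1 := by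
    rw [Matrix.diagonal_mul_diagonal, ← Matrix.diagonal_one]
    congr 1
    ext i
    rw [← Complex.ofReal_mul, inv_mul_cancel₀ (hΛ i).ne', Complex.ofReal_one]
  have hinv : (Tᴴ * (Vᴴ * Matrix.diagonal (fun i => (Λ i : ℂ)) * V) * T)⁻¹ =
      (V * T⁻¹)ᴴ * Matrix.diagonal (fun i => (((Λ i)⁻¹ : ℝ) : ℂ)) * (V * T⁻¹) := by
    refine Matrix.inv_eq_left_inv ?_
    rw [hTH, Matrix.conjTranspose_mul, Matrix.conjTranspose_nonsing_inv, hTH]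
    calc T⁻¹ * Vᴴ * Matrix.diagonal (fun i => (((Λ i)⁻¹ : ℝ) : ℂ)) * (V * T⁻¹) *
          (T * (Vᴴ * Matrix.diagonal (fun i => (Λ i : ℂ)) * V) * T)
        = T⁻¹ * Vᴴ * Matrix.diagonal (fun i => (((Λ i)⁻¹ : ℝ) : ℂ)) * (V * (T⁻¹ * T) * Vᴴ) *
            Matrix.diagonal (fun i => (Λ i : ℂ)) * V * T := by simp only [Matrix.mul_assoc]
      _ = T⁻¹ * (Vᴴ * (Matrix.diagonal (fun i => (((Λ i)⁻¹ : ℝ) : ℂ)) *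
            Matrix.diagonal (fun i => (Λ i : ℂ))) * V) * T := by
          rw [hTT, mul_one, hVV, mul_one]; simp only [Matrix.mul_assoc]
      _ = 1 := by rw [hDD, mul_one, hVV', mul_one, hTT]
  rw [gramSINR, hinv, conjTranspose_mul_diagonal_mul_apply_self, Complex.ofReal_re]
  rfl

theorem weightedNormSq_pos {a : Fin n → ℝ} (ha : ∀ i, 0 < a i) {v : Fin n → ℂ} (hv : v ≠ 0) :
    0 < weightedNormSq a v := by
  obtain ⟨i, hi⟩ := Function.ne_iff.1 hv
  exact Finset.sum_pos' (fun j _ => mul_nonneg (ha j).le (by positivity))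
    ⟨i, Finset.mem_univ i, mul_pos (ha i) (pow_pos (norm_pos_iff.2 hi) 2)⟩

theorem unitary_mulVec_ne_zero (U : Matrix.unitaryGroup (Fin n) ℂ) {v : Fin n → ℂ} (hv : v ≠ 0) :
    (U : Matrix (Fin n) (Fin n) ℂ) *ᵥ v ≠ 0 := by
  rw [Ne, ← weightedNormSq_one_eq_zero, weightedNormSq_one_mulVec, weightedNormSq_one_eq_zero]
  exact hv

theorem gramSINR_conj_pos (hS : S.PosDef) {δ : ℝ} (hδ : 0 < δ) (k : Fin n)
    (U : Matrix.unitaryGroup (Fin n) ℂ) {Λ : Fin n → ℝ} (hΛ : ∀ i, 0 < Λ i) :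
    0 < gramSINR δ S k ((U : Matrix (Fin n) (Fin n) ℂ)ᴴ *
      Matrix.diagonal (fun i => (Λ i : ℂ)) * (U : Matrix (Fin n) (Fin n) ℂ)) := by
  rw [gramSINR_conj hS δ k U hΛ]
  exact div_pos hδ (weightedNormSq_pos (fun i => inv_pos.2 (hΛ i))
    (unitary_mulVec_ne_zero U (invSqrtCol_ne_zero hS k)))

/-- As `(γ/(γ+z))^n = (1 + z/γ)^(-n)`, the Haar average applies with `a_i = (σ_k z/δ) Λ_i⁻¹`. The
factor `σ_k = |v|²` compensates the normalization by `weightedNormSq 1 v`. -/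
theorem lintegral_haarUnitary_gramSINR (hS : S.PosDef) {δ : ℝ} (hδ : 0 < δ) (k : Fin n)
    {Λ : Fin n → ℝ} (hΛ : ∀ i, 0 < Λ i) {z : ℝ} (hz : 0 < z) :
    ∫⁻ U : Matrix.unitaryGroup (Fin n) ℂ, ENNReal.ofReal ((fun y => (y / (y + z)) ^ n)
      (gramSINR δ S k ((U : Matrix (Fin n) (Fin n) ℂ)ᴴ *
        Matrix.diagonal (fun i => (Λ i : ℂ)) * (U : Matrix (Fin n) (Fin n) ℂ))))
        ∂(haarUnitary n) =
      ENNReal.ofReal (∏ i, (Λ i / (Λ i + invDiag S k / δ * z))) := by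
  have hσ := invDiag_pos hS k
  have h := lintegral_haarUnitary_inv_pow (a := fun i => invDiag S k / δ * z * (Λ i)⁻¹)
    (fun i => by have := hΛ i; positivity) (invSqrtCol_ne_zero hS k)
  have e1 : ∏ i, (Λ i / (Λ i + invDiag S k / δ * z)) =
      ∏ i, (1 + invDiag S k / δ * z * (Λ i)⁻¹)⁻¹ := by
    refine Finset.prod_congr rfl fun i _ => ?_
    have := hΛ i
    field_simp
  rw [e1, ← h]
  refine lintegral_congr fun U => ?_
  have hX := weightedNormSq_pos (fun i => inv_pos.2 (hΛ i))
    (unitary_mulVec_ne_zero U (invSqrtCol_ne_zero hS k))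
  have e2 : weightedNormSq (fun i => invDiag S k / δ * z * (Λ i)⁻¹)
      ((U : Matrix (Fin n) (Fin n) ℂ) *ᵥ invSqrtCol S k) = invDiag S k / δ * z *
      weightedNormSq (fun i => (Λ i)⁻¹) ((U : Matrix (Fin n) (Fin n) ℂ) *ᵥ invSqrtCol S k) := by
    simp only [weightedNormSq, Finset.mul_sum, mul_assoc]
  rw [e2, ← invDiag_eq_weightedNormSq hS, gramSINR_conj hS δ k U hΛ]
  congr 2
  generalize weightedNormSq (fun i => (Λ i)⁻¹)
    ((U : Matrix (Fin n) (Fin n) ℂ) *ᵥ invSqrtCol S k) = X at hX ⊢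
  field_simp

end Gram

end ZFMimo

namespace ZFMimo

/-! ### The law of the SINR -/

section Law

variable {n : ℕ} {ω : ℝ → ℝ} {S : Matrix (Fin n) (Fin n) ℂ}

/-- The map `(U, Λ) ↦ U† Λ U`. -/
noncomputable def conjDiagonal (n : ℕ) (x : Matrix.unitaryGroup (Fin n) ℂ × (Fin n → ℝ)) :
    Matrix (Fin n) (Fin n) ℂ :=
  (x.1 : Matrix (Fin n) (Fin n) ℂ)ᴴ * Matrix.diagonal (fun i => (x.2 i : ℂ)) *
    (x.1 : Matrix (Fin n) (Fin n) ℂ)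

theorem measurable_conjDiagonal (n : ℕ) : Measurable (conjDiagonal n) := by
  have h1 : Continuous fun x : Matrix.unitaryGroup (Fin n) ℂ × (Fin n → ℝ) =>
      (x.1 : Matrix (Fin n) (Fin n) ℂ) := continuous_subtype_val.comp continuous_fst
  have h2 : Continuous fun x : Matrix.unitaryGroup (Fin n) ℂ × (Fin n → ℝ) =>
      Matrix.diagonal (fun i => (x.2 i : ℂ)) :=
    Continuous.matrix_diagonal (by fun_prop)
  exact ((h1.matrix_conjTranspose.matrix_mul h2).matrix_mul h1).measurable

theorem invariantLaw_eq_map (n : ℕ) (q : ℕ → ℝ → ℝ) :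
    invariantLaw n q = ((haarUnitary n).prod ((orthantVolume n).withDensity fun Λ =>
      ENNReal.ofReal (eigenDensity n q Λ))).map (conjDiagonal n) := rfl

instance sigmaFinite_orthantVolume (n : ℕ) : SigmaFinite (orthantVolume n) := by
  unfold orthantVolume; infer_instance

theorem ae_gramSINR_pos (q : ℕ → ℝ → ℝ) (hS : S.PosDef) {δ : ℝ} (hδ : 0 < δ) (k : Fin n) :
    ∀ᵐ A ∂(invariantLaw n q), 0 < gramSINR δ S k A := by
  rw [invariantLaw_eq_map, ae_map_iff (measurable_conjDiagonal n).aemeasurable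
    (measurableSet_lt measurable_const (measurable_gramSINR δ S k))]
  have h : ∀ᵐ Λ ∂((orthantVolume n).withDensity fun Λ =>
      ENNReal.ofReal (eigenDensity n q Λ)), ∀ i, 0 < Λ i :=
    (withDensity_absolutelyContinuous _ _).ae_le (ae_orthantVolume_pos n)
  filter_upwards [Measure.quasiMeasurePreserving_snd.ae h] with x hx
  exact gramSINR_conj_pos hS hδ k x.1 hx

theorem IsPolyaWeight.lintegral_invariantLaw (h : IsPolyaWeight n ω)
    (hnn : ∀ᵐ Λ ∂(orthantVolume n), 0 ≤ eigenDensity n (polyaQ ω) Λ) (hS : S.PosDef) {δ : ℝ}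
    (hδ : 0 < δ) (k : Fin n) {z : ℝ} (hz : 0 < z) :
    ∫⁻ A, ENNReal.ofReal ((fun y => (y / (y + z)) ^ n) (gramSINR δ S k A))
        ∂(invariantLaw n (polyaQ ω)) =
      ENNReal.ofReal (∫ Λ, eigenDensity n (polyaQ ω) Λ *
        ∏ a, (Λ a / (Λ a + invDiag S k / δ * z)) ∂(orthantVolume n)) := by
  have hσ := invDiag_pos hS k
  have hc : 0 < invDiag S k / δ * z := by positivity
  have hm : Measurable fun A : Matrix (Fin n) (Fin n) ℂ =>
      ENNReal.ofReal ((fun y => (y / (y + z)) ^ n) (gramSINR δ S k A)) := by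
    have := measurable_gramSINR δ S k
    fun_prop
  have hE := h.integrable_eigenDensity
  have hEm : AEMeasurable (fun Λ => ENNReal.ofReal (eigenDensity n (polyaQ ω) Λ))
      (orthantVolume n) := hE.aestronglyMeasurable.aemeasurable.ennreal_ofReal
  have hcomp : Measurable fun x : Matrix.unitaryGroup (Fin n) ℂ × (Fin n → ℝ) =>
      ENNReal.ofReal ((fun y => (y / (y + z)) ^ n) (gramSINR δ S k (conjDiagonal n x))) :=
    hm.comp (measurable_conjDiagonal n)
  rw [invariantLaw_eq_map, lintegral_map hm (measurable_conjDiagonal n),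
    lintegral_prod_symm _ hcomp.aemeasurable,
    lintegral_withDensity_eq_lintegral_mul₀ hEm hcomp.lintegral_prod_left'.aemeasurable,
    ofReal_integral_eq_lintegral_ofReal]
  · refine lintegral_congr_ae ?_
    filter_upwards [ae_orthantVolume_pos n, hnn] with Λ hΛ h0
    rw [ENNReal.ofReal_mul h0, ← lintegral_haarUnitary_gramSINR hS hδ k hΛ hz]
    rfl
  · refine Integrable.mul_bdd (c := 1) hE (Measurable.aestronglyMeasurable (by fun_prop)) ?_
    filter_upwards [ae_orthantVolume_pos n] with Λ hΛ
    have h1 := fun a => div_add_mem_Icc (hΛ a) hc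
    rw [Real.norm_of_nonneg (Finset.prod_nonneg fun a _ => (h1 a).1)]
    exact Finset.prod_le_one (fun a _ => (h1 a).1) fun a _ => (h1 a).2
  · filter_upwards [ae_orthantVolume_pos n, hnn] with Λ hΛ h0
    exact mul_nonneg h0 (Finset.prod_nonneg fun a _ => (div_add_mem_Icc (hΛ a) hc).1)

theorem integral_div_add_pow_comp_mul (ω : ℝ → ℝ) (n : ℕ) {b z : ℝ} (hb : 0 < b) :
    ∫ y in Ioi (0 : ℝ), (y / (y + b * z)) ^ n * ω y =
      ∫ y in Ioi (0 : ℝ), (y / (y + z)) ^ n * (b * ω (b * y)) := by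
  have h := integral_comp_mul_left_Ioi (fun y => (y / (y + b * z)) ^ n * ω y) 0 hb
  rw [mul_zero, smul_eq_mul, inv_mul_eq_div, eq_div_iff hb.ne', mul_comm, ← integral_const_mul] at h
  rw [← h]
  refine integral_congr_ae (Filter.Eventually.of_forall fun y => ?_)
  simp only
  rw [← mul_add, mul_div_mul_left _ _ hb.ne']
  ring

theorem IsPolyaWeight.integrableOn_weight (h : IsPolyaWeight n ω) (hn : 2 ≤ n) :
    IntegrableOn ω (Ioi 0) := by
  simpa [weightDeriv] using h.integrableOn_weightDeriv (j := 0) (by omega)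

/-- The density of the SINR. -/
noncomputable def sinrDensity (ω : ℝ → ℝ) (σ δ γ : ℝ) : ℝ :=
  σ / (δ * mellinAt ω 1) * ω (σ * γ / δ)

theorem sinrDensity_eq (ω : ℝ → ℝ) (σ δ γ : ℝ) :
    sinrDensity ω σ δ γ = 1 / mellinAt ω 1 * (σ / δ * ω (σ / δ * γ)) := by
  rw [sinrDensity, mul_div_right_comm σ γ δ]
  ring

theorem IsPolyaWeight.integrableOn_sinrDensity (h : IsPolyaWeight n ω) (hn : 2 ≤ n) {σ δ : ℝ}
    (hσ : 0 < σ) (hδ : 0 < δ) : IntegrableOn (sinrDensity ω σ δ) (Ioi 0) := by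
  have h1 := (integrableOn_Ioi_comp_mul_left_iff ω 0 (div_pos hσ hδ)).2
    (by rw [mul_zero]; exact h.integrableOn_weight hn)
  exact ((h1.const_mul (σ / δ)).const_mul (1 / mellinAt ω 1)).congr
    (Filter.Eventually.of_forall fun y => (sinrDensity_eq ω σ δ y).symm)

theorem IsPolyaWeight.continuousOn_sinrDensity (h : IsPolyaWeight n ω) {σ δ : ℝ}
    (hσ : 0 < σ) (hδ : 0 < δ) : ContinuousOn (sinrDensity ω σ δ) (Ioi 0) := by
  refine continuousOn_const.mul (h.contDiffOn.continuousOn.comp (by fun_prop) fun y hy => ?_)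
  exact div_pos (mul_pos hσ hy) hδ

/-- Chains the Haar average, the reduction to `K(0, ·)` and the integration by parts; the rescaling
by `σ_k/δ` turns `ω` into the claimed density, and determinacy of the transform concludes. -/
theorem IsPolyaEnsemble.sinr_law {Ω : Type*} [MeasurableSpace Ω] {μ : Measure Ω}
    [IsProbabilityMeasure μ] {nr : ℕ} {P : Ω → Matrix (Fin nr) (Fin n) ℂ}
    (hP : IsPolyaEnsemble μ P ω) (hn : 2 ≤ n) (hS : S.PosDef) {δ : ℝ} (hδ : 0 < δ) (k : Fin n) :
    AEMeasurable (fun w => zfSINR δ (channel (P w) S) k) μ ∧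
    (∀ γ, 0 < γ → 0 ≤ sinrDensity ω (invDiag S k) δ γ) ∧
      μ.map (fun w => zfSINR δ (channel (P w) S) k) = (volume.restrict (Ioi 0)).withDensity
        fun γ => ENNReal.ofReal (sinrDensity ω (invDiag S k) δ γ) := by
  have hw := hP.weight
  have hσ := invDiag_pos hS k
  have hgram : AEMeasurable (fun w => (P w)ᴴ * P w) μ := by
    have h1 : Continuous fun A : Matrix (Fin nr) (Fin n) ℂ => Aᴴ * A := by fun_prop
    exact h1.measurable.comp_aemeasurable hP.ensemble.aemeasurable
  have heq : (fun w => zfSINR δ (channel (P w) S) k) =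
      gramSINR δ S k ∘ fun w => (P w)ᴴ * P w := by
    ext w; exact zfSINR_channel δ (P w) S k
  have hm : AEMeasurable (fun w => zfSINR δ (channel (P w) S) k) μ := by
    rw [heq]; exact (measurable_gramSINR δ S k).comp_aemeasurable hgram
  refine ⟨hm, ?_⟩
  have hmap : μ.map (fun w => zfSINR δ (channel (P w) S) k) =
      (invariantLaw n (polyaQ ω)).map (gramSINR δ S k) := by
    rw [heq, ← AEMeasurable.map_map_of_aemeasurable (measurable_gramSINR δ S k).aemeasurable hgram,
      hP.ensemble.map_gram]
  have : IsProbabilityMeasure (μ.map (fun w => zfSINR δ (channel (P w) S) k)) :=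
    Measure.isProbabilityMeasure_map hm
  have hpos : ∀ᵐ y ∂(μ.map (fun w => zfSINR δ (channel (P w) S) k)), 0 < y := by
    rw [hmap, ae_map_iff (measurable_gramSINR δ S k).aemeasurable measurableSet_Ioi]
    exact ae_gramSINR_pos _ hS hδ k
  refine eq_withDensity_of_integral_div_add_pow hpos (hw.continuousOn_sinrDensity hσ hδ)
    (hw.integrableOn_sinrDensity hn hσ hδ) (n := n) (by omega) fun z hz => ?_
  have hc : 0 < invDiag S k / δ * z := by positivity
  have hnonneg : 0 ≤ ∫ Λ, eigenDensity n (polyaQ ω) Λ *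
      ∏ a, (Λ a / (Λ a + invDiag S k / δ * z)) ∂(orthantVolume n) := by
    refine integral_nonneg_of_ae ?_
    filter_upwards [ae_orthantVolume_pos n, hP.ensemble.density_nonneg] with Λ hΛ h0
    exact mul_nonneg h0 (Finset.prod_nonneg fun a _ => (div_add_mem_Icc (hΛ a) hc).1)
  rw [integral_eq_lintegral_of_nonneg_ae
    (hpos.mono fun y hy => by simp only [Pi.zero_apply]; positivity)
    (Measurable.aestronglyMeasurable (by fun_prop)), hmap,
    lintegral_map (by fun_prop) (measurable_gramSINR δ S k),
    hw.lintegral_invariantLaw hP.ensemble.density_nonneg hS hδ k hz,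
    ENNReal.toReal_ofReal hnonneg, hw.integral_eigenDensity_mul_prod hn hc,
    hw.integral_div_add_mul_polyaKernel hn hc,
    integral_div_add_pow_comp_mul ω n (div_pos hσ hδ), ← integral_const_mul]
  refine integral_congr_ae (Filter.Eventually.of_forall fun y => ?_)
  simp only [sinrDensity_eq]
  ring

end Law

end ZFMimo

/-! ### The Mellin transform of `log (1 + 1 / x)` -/

namespace ZFMimo

section Mellin

theorem mellinConvergent_inv_one_add {s : ℂ} (h0 : 0 < s.re) (h1 : s.re < 1) :
    MellinConvergent (fun x : ℝ => (((1 + x)⁻¹ : ℝ) : ℂ)) s := by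
  have hc : ContinuousOn (fun x : ℝ => (((1 + x)⁻¹ : ℝ) : ℂ)) (Ioi 0) := by
    refine Complex.continuous_ofReal.comp_continuousOn (ContinuousOn.inv₀ (by fun_prop) ?_)
    intro x hx
    have : (0 : ℝ) < x := hx
    positivity
  refine mellinConvergent_of_isBigO_rpow (a := 1) (b := 0)
    (hc.locallyIntegrableOn measurableSet_Ioi) ?_ h1 ?_ h0
  · refine Asymptotics.IsBigO.of_bound 1 ?_
    filter_upwards [Filter.eventually_gt_atTop 0] with x hx
    rw [Complex.norm_real, Real.rpow_neg_one, one_mul, Real.norm_of_nonneg (by positivity),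
      Real.norm_of_nonneg (by positivity)]
    exact inv_anti₀ hx (by linarith)
  · refine Asymptotics.IsBigO.of_bound 1 ?_
    filter_upwards [self_mem_nhdsWithin] with x hx
    have hx : (0 : ℝ) < x := hx
    rw [Complex.norm_real, neg_zero, Real.rpow_zero, Real.norm_of_nonneg (by positivity)]
    simpa using inv_le_one_of_one_le₀ (by linarith : 1 ≤ 1 + x)

theorem integral_exp_neg_one_add_mul {x : ℝ} (hx : 0 < x) :
    ∫ t in Ioi (0 : ℝ), (Real.exp (-(x * t)) * Real.exp (-t) : ℝ) = (1 + x)⁻¹ := by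
  have h := integral_exp_mul_Ioi (a := -(1 + x)) (by linarith) 0
  rw [mul_zero, Real.exp_zero] at h
  rw [neg_div_neg_eq, one_div] at h
  rw [← h]
  refine integral_congr_ae (Filter.Eventually.of_forall fun t => ?_)
  simp only [← Real.exp_add]
  congr 1
  ring

/-- Insert `(1 + x)⁻¹ = ∫ exp(-xt) exp(-t) dt` and exchange the integrals: the `x`-integral gives
`Γ(s) t^(-s)`, the remaining `t`-integral `Γ(1-s)`. -/
theorem mellin_inv_one_add {s : ℂ} (h0 : 0 < s.re) (h1 : s.re < 1) :
    mellin (fun x : ℝ => (((1 + x)⁻¹ : ℝ) : ℂ)) s = Complex.Gamma s * Complex.Gamma (1 - s) := by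
  set F : ℝ → ℝ → ℂ := fun x t =>
    (x : ℂ) ^ (s - 1) * ((Real.exp (-(x * t)) * Real.exp (-t) : ℝ) : ℂ) with hF
  have hinner : ∀ t : ℝ, 0 < t → ∫ x in Ioi (0 : ℝ), F x t =
      Complex.Gamma s * ((Real.exp (-t) : ℂ) * (t : ℂ) ^ ((1 - s) - 1)) := fun t ht => by
    have h := Complex.integral_cpow_mul_exp_neg_mul_Ioi h0 ht
    have e : ∀ x : ℝ, F x t = (x : ℂ) ^ (s - 1) * Complex.exp (-((t : ℂ) * x)) *
        (Real.exp (-t) : ℂ) := fun x => by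
      simp only [hF]
      push_cast
      rw [mul_comm (x : ℂ) t]
      ring
    simp only [e]
    rw [integral_mul_const, h, one_div,
      Complex.inv_cpow _ _ (by rw [Complex.arg_ofReal_of_nonneg ht.le]; exact Real.pi_pos.ne),
      ← Complex.cpow_neg]
    have : 1 - s - 1 = -s := by ring
    rw [this]
    ring
  have hnorm : ∀ x t : ℝ, 0 < x → ‖F x t‖ =
      x ^ (s.re - 1) * Real.exp (-(t * x)) * Real.exp (-t) := fun x t hx => by
    simp only [hF]
    rw [norm_mul, Complex.norm_cpow_eq_rpow_re_of_pos hx, Complex.norm_real,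
      Real.norm_of_nonneg (by positivity), Complex.sub_re, Complex.one_re, mul_comm x t]
    ring
  have hFm : Measurable (Function.uncurry F) := by
    simp only [hF]
    refine Measurable.mul ?_ ?_
    · exact (Complex.measurable_ofReal.comp measurable_fst).pow_const _
    · fun_prop
  have hint : Integrable (Function.uncurry F)
      ((volume.restrict (Ioi 0)).prod (volume.restrict (Ioi (0 : ℝ)))) := by
    rw [integrable_prod_iff' hFm.aestronglyMeasurable]
    have hr : ∀ t : ℝ, 0 < t → IntegrableOn (fun x : ℝ =>
        x ^ (s.re - 1) * Real.exp (-(t * x)) * Real.exp (-t)) (Ioi 0) := fun t ht => by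
      refine Integrable.mul_const ?_ _
      have := integrableOn_rpow_mul_exp_neg_mul_rpow (s := s.re - 1) (p := 1) (b := t)
        (by linarith) one_pos ht
      simpa [IntegrableOn] using this
    refine ⟨?_, ?_⟩
    · filter_upwards [ae_restrict_mem measurableSet_Ioi] with t ht
      refine (hr t ht).mono' (hFm.comp (by fun_prop : Measurable fun x : ℝ => (x, t))).aestronglyMeasurable ?_
      filter_upwards [ae_restrict_mem measurableSet_Ioi] with x hx
      exact (hnorm x t hx).le
    · have hG := (Real.GammaIntegral_convergent (s := 1 - s.re) (by linarith)).const_mul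
        (Real.Gamma s.re)
      refine hG.congr ?_
      filter_upwards [ae_restrict_mem measurableSet_Ioi] with t ht
      have ht : (0 : ℝ) < t := ht
      have e : ∫ x in Ioi (0 : ℝ), ‖F x t‖ =
          ∫ x in Ioi (0 : ℝ), x ^ (s.re - 1) * Real.exp (-(t * x)) * Real.exp (-t) :=
        setIntegral_congr_fun measurableSet_Ioi fun x hx => hnorm x t hx
      have e2 : ∫ x in Ioi (0 : ℝ), ‖Function.uncurry F (x, t)‖ = ∫ x in Ioi (0 : ℝ), ‖F x t‖ := rfl
      rw [e2, e, integral_mul_const, Real.integral_rpow_mul_exp_neg_mul_Ioi h0 ht, one_div,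
        Real.inv_rpow ht.le, ← Real.rpow_neg ht.le]
      have : 1 - s.re - 1 = -s.re := by ring
      rw [this]
      ring
  have hswap := integral_integral_swap hint
  have hL : ∫ x in Ioi (0 : ℝ), ∫ t in Ioi (0 : ℝ), F x t =
      mellin (fun x : ℝ => (((1 + x)⁻¹ : ℝ) : ℂ)) s := by
    refine setIntegral_congr_fun measurableSet_Ioi fun x hx => ?_
    simp only [hF, smul_eq_mul]
    rw [integral_const_mul, integral_complex_ofReal, integral_exp_neg_one_add_mul hx]
  have hR : ∫ t in Ioi (0 : ℝ), ∫ x in Ioi (0 : ℝ), F x t =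
      Complex.Gamma s * Complex.Gamma (1 - s) := by
    rw [setIntegral_congr_fun measurableSet_Ioi fun t ht => hinner t ht, integral_const_mul,
      Complex.Gamma_eq_integral (s := 1 - s) (by simpa using h1)]
    rfl
  rw [← hL, hswap, hR]

theorem log_one_add_inv_nonneg {x : ℝ} (hx : 0 < x) : 0 ≤ Real.log (1 + x⁻¹) :=
  Real.log_nonneg (by have := inv_pos.2 hx; linarith)

theorem log_one_add_inv_le_inv {x : ℝ} (hx : 0 < x) : Real.log (1 + x⁻¹) ≤ x⁻¹ := by
  have := Real.log_le_sub_one_of_pos (by positivity : 0 < 1 + x⁻¹)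
  linarith

theorem log_one_add_inv_le_rpow {x ε : ℝ} (hx : 0 < x) (hx1 : x ≤ 1) (hε : 0 < ε) :
    Real.log (1 + x⁻¹) ≤ 2 ^ ε / ε * x ^ (-ε) := by
  have h1 : (1 : ℝ) + x⁻¹ ≤ 2 * x⁻¹ := by
    have := (one_le_inv₀ hx).2 hx1
    linarith
  calc Real.log (1 + x⁻¹) ≤ (1 + x⁻¹) ^ ε / ε := Real.log_le_rpow_div (by positivity) hε
    _ ≤ (2 * x⁻¹) ^ ε / ε := by gcongr
    _ = 2 ^ ε / ε * x ^ (-ε) := by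
      rw [Real.mul_rpow (by norm_num) (by positivity), Real.inv_rpow hx.le, Real.rpow_neg hx.le]
      ring

theorem continuousOn_log_one_add_inv :
    ContinuousOn (fun x : ℝ => Real.log (1 + x⁻¹)) (Ioi 0) := by
  refine ContinuousOn.log (continuousOn_const.add (continuousOn_id.inv₀ fun x hx => ne_of_gt hx)) ?_
  intro x hx
  have : (0 : ℝ) < x := hx
  change (1 : ℝ) + x⁻¹ ≠ 0
  positivity

theorem mellinConvergent_log_one_add_inv {s : ℂ} (h0 : 0 < s.re) (h1 : s.re < 1) :
    MellinConvergent (fun x : ℝ => ((Real.log (1 + x⁻¹) : ℝ) : ℂ)) s := by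
  refine mellinConvergent_of_isBigO_rpow (a := 1) (b := s.re / 2)
    ((Complex.continuous_ofReal.comp_continuousOn
      continuousOn_log_one_add_inv).locallyIntegrableOn measurableSet_Ioi) ?_ h1 ?_ (by linarith)
  · refine Asymptotics.IsBigO.of_bound 1 ?_
    filter_upwards [Filter.eventually_gt_atTop 0] with x hx
    rw [Complex.norm_real, Real.rpow_neg_one, one_mul,
      Real.norm_of_nonneg (log_one_add_inv_nonneg hx), Real.norm_of_nonneg (by positivity)]
    exact log_one_add_inv_le_inv hx
  · refine Asymptotics.IsBigO.of_bound (2 ^ (s.re / 2) / (s.re / 2)) ?_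
    filter_upwards [Ioc_mem_nhdsGT (zero_lt_one' ℝ)] with x hx
    rw [Complex.norm_real, Real.norm_of_nonneg (log_one_add_inv_nonneg hx.1),
      Real.norm_of_nonneg (Real.rpow_nonneg hx.1.le _)]
    exact log_one_add_inv_le_rpow hx.1 hx.2 (by linarith)

/-- Integration by parts against `x^s/s`, since `ln(1 + 1/x)` has derivative `-1/(x(1+x))`. The
boundary terms vanish because the logarithm is `O(x^(-ε))` at `0` and at most `1/x` at infinity. -/
theorem mellin_log_one_add_inv {s : ℂ} (h0 : 0 < s.re) (h1 : s.re < 1) :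
    mellin (fun x : ℝ => ((Real.log (1 + x⁻¹) : ℝ) : ℂ)) s =
      Complex.Gamma s * Complex.Gamma (1 - s) / s := by
  have hs : s ≠ 0 := fun h => by rw [h] at h0; simp at h0
  set u : ℝ → ℂ := fun x => ((Real.log (1 + x⁻¹) : ℝ) : ℂ) with hu
  set u' : ℝ → ℂ := fun x => ((-(x⁻¹ * (1 + x)⁻¹) : ℝ) : ℂ) with hu'
  set v : ℝ → ℂ := fun x => (x : ℂ) ^ s / s with hv
  set v' : ℝ → ℂ := fun x => (x : ℂ) ^ (s - 1) with hv'
  have du : ∀ x ∈ Ioi (0 : ℝ), HasDerivAt u (u' x) x := fun x hx => by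
    have hx : (0 : ℝ) < x := hx
    refine HasDerivAt.ofReal_comp ?_
    refine (((hasDerivAt_inv hx.ne').const_add 1).log (by positivity)).congr_deriv ?_
    field_simp
    ring
  have dv : ∀ x ∈ Ioi (0 : ℝ), HasDerivAt v (v' x) x := fun x hx => by
    have hx : (0 : ℝ) < x := hx
    exact ((hasDerivAt_ofReal_cpow_const hx.ne' hs).div_const s).congr_deriv
      (mul_div_cancel_left₀ _ hs)
  have e2 : ∀ x ∈ Ioi (0 : ℝ), u' x * v x =
      -(1 / s) * ((x : ℂ) ^ (s - 1) • (((1 + x)⁻¹ : ℝ) : ℂ)) := fun x hx => by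
    have hx' : (x : ℂ) ≠ 0 := Complex.ofReal_ne_zero.2 (ne_of_gt hx)
    simp only [hu', hv, smul_eq_mul]
    rw [Complex.cpow_sub _ _ hx', Complex.cpow_one]
    push_cast
    field_simp
  have i1 : IntegrableOn (u * v') (Ioi 0) := by
    refine (mellinConvergent_log_one_add_inv h0 h1).congr
      (Filter.Eventually.of_forall fun x => ?_)
    simp [hu, hv', mul_comm]
  have i2 : IntegrableOn (u' * v) (Ioi 0) :=
    (Integrable.const_mul (mellinConvergent_inv_one_add h0 h1) (-(1 / s))).congr (by
      filter_upwards [ae_restrict_mem measurableSet_Ioi] with x hx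
      exact (e2 x hx).symm)
  have hnorm : ∀ x : ℝ, 0 < x → ‖(u * v) x‖ = Real.log (1 + x⁻¹) * x ^ s.re / ‖s‖ := fun x hx => by
    simp only [hu, hv, Pi.mul_apply]
    rw [norm_mul, norm_div, Complex.norm_real, Complex.norm_cpow_eq_rpow_re_of_pos hx,
      Real.norm_of_nonneg (log_one_add_inv_nonneg hx)]
    ring
  have t0 : Filter.Tendsto (u * v) (nhdsWithin 0 (Ioi 0)) (nhds 0) := by
    have hlim : Filter.Tendsto (fun x : ℝ => 2 ^ (s.re / 2) / (s.re / 2) * x ^ (s.re / 2) / ‖s‖)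
        (nhdsWithin 0 (Ioi 0)) (nhds 0) := by
      have : ContinuousAt (fun x : ℝ => 2 ^ (s.re / 2) / (s.re / 2) * x ^ (s.re / 2) / ‖s‖) 0 :=
        ((Real.continuousAt_rpow_const 0 (s.re / 2) (Or.inr (by linarith))).const_mul _).div_const _
      have h2 := this.tendsto.mono_left (nhdsWithin_le_nhds (s := Ioi 0))
      rwa [Real.zero_rpow (by linarith), mul_zero, zero_div] at h2
    refine squeeze_zero_norm' ?_ hlim
    filter_upwards [Ioc_mem_nhdsGT (zero_lt_one' ℝ)] with x hx
    rw [hnorm x hx.1]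
    refine div_le_div_of_nonneg_right ?_ (norm_nonneg s)
    calc Real.log (1 + x⁻¹) * x ^ s.re
        ≤ 2 ^ (s.re / 2) / (s.re / 2) * x ^ (-(s.re / 2)) * x ^ s.re :=
          mul_le_mul_of_nonneg_right (log_one_add_inv_le_rpow hx.1 hx.2 (by linarith))
            (Real.rpow_nonneg hx.1.le _)
      _ = 2 ^ (s.re / 2) / (s.re / 2) * x ^ (s.re / 2) := by
          rw [mul_assoc, ← Real.rpow_add hx.1]
          congr 2
          ring
  have t1 : Filter.Tendsto (u * v) Filter.atTop (nhds 0) := by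
    have hlim : Filter.Tendsto (fun x : ℝ => x ^ (-(1 - s.re)) / ‖s‖) Filter.atTop (nhds 0) := by
      simpa using (tendsto_rpow_neg_atTop (by linarith : 0 < 1 - s.re)).div_const ‖s‖
    refine squeeze_zero_norm' ?_ hlim
    filter_upwards [Filter.eventually_gt_atTop 0] with x hx
    rw [hnorm x hx]
    refine div_le_div_of_nonneg_right ?_ (norm_nonneg s)
    calc Real.log (1 + x⁻¹) * x ^ s.re ≤ x⁻¹ * x ^ s.re :=
          mul_le_mul_of_nonneg_right (log_one_add_inv_le_inv hx) (Real.rpow_nonneg hx.le _)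
      _ = x ^ (-(1 - s.re)) := by
          rw [← Real.rpow_neg_one, ← Real.rpow_add hx]
          congr 1
          ring
  have key := integral_Ioi_mul_deriv_eq_deriv_mul du dv i1 i2 t0 t1
  rw [setIntegral_congr_fun measurableSet_Ioi e2, integral_const_mul] at key
  have e3 : mellin u s = ∫ x in Ioi (0 : ℝ), u x * v' x := by
    refine setIntegral_congr_fun measurableSet_Ioi fun x _ => ?_
    simp [hv', mul_comm]
  have e4 : ∫ x in Ioi (0 : ℝ), (x : ℂ) ^ (s - 1) • (((1 + x)⁻¹ : ℝ) : ℂ) =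
      Complex.Gamma s * Complex.Gamma (1 - s) := mellin_inv_one_add h0 h1
  rw [e3, key, e4]
  ring

/-- On the line, `|sin πs|² = sin²(πr) + sinh²(πt)`. Replacing the exponential growth by `sinh²(πt)
≥ t²` is enough: with the factor `1/s` it makes the Mellin transform `O(1/(1+t²))`. -/
theorem norm_sin_pi_mul_ge {r : ℝ} (h0 : 0 < r) (h1 : r < 1) (t : ℝ) :
    Real.sin (Real.pi * r) ^ 2 * (1 + t ^ 2) ≤
      ‖Complex.sin ((Real.pi : ℂ) * ((r : ℂ) + t * Complex.I))‖ ^ 2 := by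
  have e : (Real.pi : ℂ) * ((r : ℂ) + t * Complex.I) =
      ((Real.pi * r : ℝ) : ℂ) + ((Real.pi * t : ℝ) : ℂ) * Complex.I := by push_cast; ring
  have hsinh : t ^ 2 ≤ Real.sinh (Real.pi * t) ^ 2 := by
    rw [sq_le_sq]
    have h3 : |t| ≤ |Real.pi * t| := by
      rw [abs_mul, abs_of_pos Real.pi_pos]
      nlinarith [Real.pi_gt_three, abs_nonneg t]
    refine h3.trans ?_
    rw [Real.abs_sinh]
    exact Real.self_le_sinh_iff.2 (abs_nonneg _)
  rw [e, Complex.sin_add_mul_I, ← Complex.ofReal_sin, ← Complex.ofReal_cos, ← Complex.ofReal_sinh,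
    ← Complex.ofReal_cosh, ← Complex.ofReal_mul, ← Complex.ofReal_mul, ← Complex.normSq_eq_norm_sq,
    Complex.normSq_add_mul_I]
  have hc := Real.cosh_sq (Real.pi * t)
  have hsc := Real.sin_sq_add_cos_sq (Real.pi * r)
  have hle : Real.sin (Real.pi * r) ^ 2 ≤ 1 := Real.sin_sq_le_one _
  have expand : (Real.sin (Real.pi * r) * Real.cosh (Real.pi * t)) ^ 2 +
      (Real.cos (Real.pi * r) * Real.sinh (Real.pi * t)) ^ 2 =
      Real.sin (Real.pi * r) ^ 2 + Real.sinh (Real.pi * t) ^ 2 := by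
    rw [mul_pow, mul_pow, hc]
    linear_combination Real.sinh (Real.pi * t) ^ 2 * hsc
  rw [expand]
  nlinarith [sq_nonneg t]

theorem verticalIntegrable_mellin_log_one_add_inv {r : ℝ} (h0 : 0 < r) (h1 : r < 1) :
    Complex.VerticalIntegrable (mellin fun x : ℝ => ((Real.log (1 + x⁻¹) : ℝ) : ℂ)) r := by
  have heq : (fun t : ℝ => mellin (fun x : ℝ => ((Real.log (1 + x⁻¹) : ℝ) : ℂ))
      ((r : ℂ) + t * Complex.I)) = fun t : ℝ => (Real.pi : ℂ) /
        Complex.sin ((Real.pi : ℂ) * ((r : ℂ) + t * Complex.I)) / ((r : ℂ) + t * Complex.I) := by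
    ext t
    rw [mellin_log_one_add_inv (by simpa using h0) (by simpa using h1),
      Complex.Gamma_mul_Gamma_one_sub]
  have hsin : 0 < Real.sin (Real.pi * r) :=
    Real.sin_pos_of_pos_of_lt_pi (by positivity) (by nlinarith [Real.pi_pos])
  have hS : ∀ t : ℝ, 0 < ‖Complex.sin ((Real.pi : ℂ) * ((r : ℂ) + t * Complex.I))‖ := fun t => by
    have := norm_sin_pi_mul_ge h0 h1 t
    have h2 : 0 < Real.sin (Real.pi * r) ^ 2 * (1 + t ^ 2) := by positivity
    exact lt_of_le_of_ne (norm_nonneg _) fun h => by rw [← h] at this; norm_num at this; linarith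
  have hN : ∀ t : ℝ, r ^ 2 * (1 + t ^ 2) ≤ ‖(r : ℂ) + t * Complex.I‖ ^ 2 := fun t => by
    rw [← Complex.normSq_eq_norm_sq, Complex.normSq_add_mul_I]
    nlinarith [mul_nonneg (sq_nonneg t) (sub_nonneg.2 (pow_le_one₀ h0.le h1.le : r ^ 2 ≤ 1))]
  have hNpos : ∀ t : ℝ, 0 < ‖(r : ℂ) + t * Complex.I‖ := fun t => by
    have := hN t
    have h2 : 0 < r ^ 2 * (1 + t ^ 2) := by positivity
    exact lt_of_le_of_ne (norm_nonneg _) fun h => by rw [← h] at this; norm_num at this; linarith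
  unfold Complex.VerticalIntegrable
  rw [heq]
  refine (integrable_inv_one_add_sq.const_mul (Real.pi / (r * Real.sin (Real.pi * r)))).mono'
    (Continuous.aestronglyMeasurable ?_) (Filter.Eventually.of_forall fun t => ?_)
  · refine ((continuous_const.div (by fun_prop) fun t => ?_).div (by fun_prop) fun t => ?_)
    · exact norm_pos_iff.1 (hS t)
    · exact norm_pos_iff.1 (hNpos t)
  · rw [norm_div, norm_div, Complex.norm_real, Real.norm_of_nonneg Real.pi_pos.le, div_div,
      ← div_eq_mul_inv, div_div]
    have hprod : r * Real.sin (Real.pi * r) * (1 + t ^ 2) ≤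
        ‖Complex.sin ((Real.pi : ℂ) * ((r : ℂ) + t * Complex.I))‖ * ‖(r : ℂ) + t * Complex.I‖ := by
      refine le_of_sq_le_sq ?_ (by have := hS t; have := hNpos t; positivity)
      have h3 := mul_le_mul (norm_sin_pi_mul_ge h0 h1 t) (hN t) (by positivity) (by positivity)
      calc _ = Real.sin (Real.pi * r) ^ 2 * (1 + t ^ 2) * (r ^ 2 * (1 + t ^ 2)) := by ring
        _ ≤ _ := h3
        _ = _ := by ring
    exact div_le_div_of_nonneg_left Real.pi_pos.le (by positivity) hprod

/-- `Γ(1+s) = s Γ(s)` reduces the quotient of Gamma functions to `Γ(s)Γ(1-s)/s`, and `x^s =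
(1/x)^(-s)` brings it to the form of Mellin inversion at the point `1/x`. -/
theorem meijerIntegrand_eq {x r : ℝ} (hx : 0 < x) (h0 : 0 < r) (h1 : r < 1) (t : ℝ) :
    meijerIntegrand [1, 1] [] [1] [0] x ((r : ℂ) + t * Complex.I) =
      ((x⁻¹ : ℝ) : ℂ) ^ (-((r : ℂ) + t * Complex.I)) •
        mellin (fun x : ℝ => ((Real.log (1 + x⁻¹) : ℝ) : ℂ)) ((r : ℂ) + t * Complex.I) := by
  set s : ℂ := (r : ℂ) + t * Complex.I with hs
  have hre : s.re = r := by simp [hs]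
  have hs0 : s ≠ 0 := fun h => by rw [h] at hre; simp at hre; linarith
  have hG : Complex.Gamma s ≠ 0 := Complex.Gamma_ne_zero_of_re_pos (by rw [hre]; exact h0)
  rw [mellin_log_one_add_inv (by rw [hre]; exact h0) (by rw [hre]; exact h1), Complex.ofReal_inv,
    Complex.inv_cpow _ _ (by rw [Complex.arg_ofReal_of_nonneg hx.le]; exact Real.pi_pos.ne),
    Complex.cpow_neg, inv_inv, smul_eq_mul]
  simp only [meijerIntegrand, List.map_cons, List.map_nil, List.prod_cons, List.prod_nil, mul_one,
    sub_self, zero_add, sub_zero, one_mul]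
  rw [add_comm 1 s, Complex.Gamma_add_one s hs0]
  field_simp

theorem meijerG_eq_log {x r : ℝ} (hx : 0 < x) (hr : Separates r [1, 1] [1]) :
    meijerG r [1, 1] [] [1] [0] x = ((Real.log (1 + x) : ℝ) : ℂ) := by
  have h0 : 0 < r := by simpa using hr.1 1 (by simp)
  have h1 : r < 1 := by simpa using hr.2 1 (by simp)
  have hx' : 0 < x⁻¹ := inv_pos.2 hx
  have h := mellinInv_mellin_eq r (fun x : ℝ => ((Real.log (1 + x⁻¹) : ℝ) : ℂ)) hx'
    (mellinConvergent_log_one_add_inv (by simpa using h0) (by simpa using h1))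
    (verticalIntegrable_mellin_log_one_add_inv h0 h1)
    (Complex.continuous_ofReal.continuousAt.comp
      (continuousOn_log_one_add_inv.continuousAt (Ioi_mem_nhds hx')))
  rw [inv_inv] at h
  rw [← h, mellinInv, meijerG]
  simp only [meijerIntegrand_eq hx h0 h1]
  rw [Complex.real_smul]
  push_cast
  rfl

end Mellin

end ZFMimo

/-! ### The sum rate -/

namespace ZFMimo

section SumRate

theorem IsPolyaWeight.integrableOn_id_mul {n : ℕ} {ω : ℝ → ℝ} (h : IsPolyaWeight n ω)
    (hn : 2 ≤ n) : IntegrableOn (fun x => x * ω x) (Ioi 0) := by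
  simpa [weightDeriv] using h.integrableOn_pow_mul (a := 1) (b := 0) (by omega) (by omega)

/-- `ln(1 + cx) ≤ cx`, and the first moment of `ω` is finite; this moment is among the hypotheses
because `n ≥ 2`. -/
theorem IsPolyaWeight.integrableOn_mul_log {n : ℕ} {ω : ℝ → ℝ} (h : IsPolyaWeight n ω)
    (hn : 2 ≤ n) {c : ℝ} (hc : 0 < c) :
    IntegrableOn (fun x => ω x * Real.log (1 + c * x)) (Ioi 0) := by
  refine ((h.integrableOn_id_mul hn).norm.const_mul c).mono' ?_ ?_
  · exact (h.integrableOn_weight hn).aestronglyMeasurable.mul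
      (Real.measurable_log.comp (by fun_prop)).aestronglyMeasurable
  · filter_upwards [ae_restrict_mem measurableSet_Ioi] with x hx
    have hx : 0 < x := hx
    have h0 : 0 < c * x := by positivity
    have h1 : Real.log (1 + c * x) ≤ c * x := by
      linarith [Real.log_le_sub_one_of_pos (by linarith : 0 < 1 + c * x)]
    rw [norm_mul, norm_mul, Real.norm_of_nonneg (Real.log_nonneg (by linarith)),
      Real.norm_of_nonneg hx.le]
    calc ‖ω x‖ * Real.log (1 + c * x) ≤ ‖ω x‖ * (c * x) :=
          mul_le_mul_of_nonneg_left h1 (norm_nonneg _)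
      _ = c * (x * ‖ω x‖) := by ring

theorem integrable_and_integral_comp_of_map_eq_withDensity {Ω : Type*} [MeasurableSpace Ω]
    {μ : Measure Ω} {X : Ω → ℝ} {ν : Measure ℝ} {ρ g : ℝ → ℝ} (hX : AEMeasurable X μ)
    (hρm : AEMeasurable ρ ν) (hρ : ∀ᵐ x ∂ν, 0 ≤ ρ x) (hg : Measurable g)
    (hlaw : μ.map X = ν.withDensity fun x => ENNReal.ofReal (ρ x))
    (hint : Integrable (fun x => ρ x * g x) ν) :
    Integrable (fun w => g (X w)) μ ∧ ∫ w, g (X w) ∂μ = ∫ x, ρ x * g x ∂ν := by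
  have hfin : ∀ᵐ x ∂ν, ENNReal.ofReal (ρ x) < ⊤ := Filter.Eventually.of_forall fun _ =>
    ENNReal.ofReal_lt_top
  have hcongr : (fun x => (ENNReal.ofReal (ρ x)).toReal • g x) =ᵐ[ν] fun x => ρ x * g x := by
    filter_upwards [hρ] with x hx
    rw [ENNReal.toReal_ofReal hx, smul_eq_mul]
  refine ⟨?_, ?_⟩
  · refine (integrable_map_measure hg.aestronglyMeasurable hX).1 ?_
    rw [hlaw, integrable_withDensity_iff_integrable_smul₀' hρm.ennreal_ofReal hfin]
    exact hint.congr hcongr.symm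
  · rw [← integral_map hX hg.aestronglyMeasurable, hlaw,
      integral_withDensity_eq_integral_toReal_smul₀ hρm.ennreal_ofReal hfin]
    exact integral_congr_ae hcongr

variable {Ω : Type*} [MeasurableSpace Ω] {μ : Measure Ω} [IsProbabilityMeasure μ] {nr nt : ℕ}
  {ω : ℝ → ℝ} {P : Ω → Matrix (Fin nr) (Fin nt) ℂ} {S : Matrix (Fin nt) (Fin nt) ℂ} {δ : ℝ}

/-- The substitution `γ = (δ/σ_k) x` moves the scale from the density into the logarithm. -/
theorem IsPolyaEnsemble.integrable_and_integral_log_one_add_zfSINR (hP : IsPolyaEnsemble μ P ω)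
    (hn : 2 ≤ nt) (hS : S.PosDef) (hδ : 0 < δ) (k : Fin nt) :
    Integrable (fun w => Real.log (1 + zfSINR δ (channel (P w) S) k)) μ ∧
      ∫ w, Real.log (1 + zfSINR δ (channel (P w) S) k) ∂μ =
        1 / mellinAt ω 1 * ∫ x in Ioi (0 : ℝ), ω x * Real.log (1 + δ / invDiag S k * x) := by
  obtain ⟨hm, hpos, hlaw⟩ := hP.sinr_law hn hS hδ k
  have hσ := invDiag_pos hS k
  have hc : 0 < invDiag S k / δ := div_pos hσ hδ
  set σ := invDiag S k
  set F : ℝ → ℝ := fun x => ω x * Real.log (1 + δ / σ * x) with hF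
  have hFint : IntegrableOn F (Ioi 0) := hP.weight.integrableOn_mul_log hn (div_pos hδ hσ)
  have e : (fun x => sinrDensity ω σ δ x * Real.log (1 + x)) =
      fun x => σ / (δ * mellinAt ω 1) * F (σ / δ * x) := by
    ext x
    simp only [sinrDensity, hF]
    have h1 : δ / σ * (σ / δ * x) = x := by field_simp
    have h2 : σ / δ * x = σ * x / δ := by ring
    rw [h1, h2]
    ring
  have hint : Integrable (fun x => sinrDensity ω σ δ x * Real.log (1 + x))
      (volume.restrict (Ioi 0)) := by
    rw [e]
    refine Integrable.const_mul ?_ _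
    have := (integrableOn_Ioi_comp_mul_left_iff F 0 hc).2 (by simpa using hFint)
    exact this
  obtain ⟨h1, h2⟩ := integrable_and_integral_comp_of_map_eq_withDensity hm
    (hP.weight.integrableOn_sinrDensity hn hσ hδ).aestronglyMeasurable.aemeasurable
    (by filter_upwards [ae_restrict_mem measurableSet_Ioi] with x hx using hpos x hx)
    (Real.measurable_log.comp (by fun_prop : Measurable fun x : ℝ => 1 + x)) hlaw hint
  refine ⟨h1, h2.trans ?_⟩
  simp only [Function.comp_apply]
  rw [e, integral_const_mul, integral_comp_mul_left_Ioi F 0 hc, mul_zero, smul_eq_mul]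
  field_simp

theorem ofReal_integral_mul_log {c r : ℝ} (hc : 0 < c) (hr : Separates r [1, 1] [1]) :
    ((∫ x in Ioi (0 : ℝ), ω x * Real.log (1 + c * x) : ℝ) : ℂ) =
      ∫ x in Ioi (0 : ℝ), (ω x : ℂ) * meijerG r [1, 1] [] [1] [0] (c * x) := by
  rw [← integral_complex_ofReal]
  refine setIntegral_congr_fun measurableSet_Ioi fun x hx => ?_
  rw [meijerG_eq_log (mul_pos hc hx) hr, Complex.ofReal_mul]

theorem IsPolyaWeight.integrableOn_mul_meijerG {n : ℕ} (h : IsPolyaWeight n ω) (hn : 2 ≤ n)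
    {c r : ℝ} (hc : 0 < c) (hr : Separates r [1, 1] [1]) :
    IntegrableOn (fun x : ℝ => (ω x : ℂ) * meijerG r [1, 1] [] [1] [0] (c * x)) (Ioi 0) := by
  refine (Integrable.ofReal (𝕜 := ℂ) (h.integrableOn_mul_log hn hc)).congr ?_
  filter_upwards [ae_restrict_mem measurableSet_Ioi] with x hx
  rw [meijerG_eq_log (mul_pos hc hx) hr]
  push_cast
  rfl

theorem IsPolyaEnsemble.integrableOn_and_zfSumRate_eq (hP : IsPolyaEnsemble μ P ω)
    (hn : 2 ≤ nt) (hS : S.PosDef) (hδ : 0 < δ) {r : ℝ} (hr : Separates r [1, 1] [1]) :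
    IntegrableOn (fun x : ℝ => (ω x : ℂ) *
        ∑ k : Fin nt, meijerG r [1, 1] [] [1] [0] (δ * x / invDiag S k)) (Ioi 0) ∧
      (zfSumRate μ δ (fun w => channel (P w) S) : ℂ) =
        1 / (mellinAt ω 1 : ℂ) * ∫ x in Ioi (0 : ℝ), (ω x : ℂ) *
          ∑ k : Fin nt, meijerG r [1, 1] [] [1] [0] (δ * x / invDiag S k) := by
  have hpos : ∀ k, 0 < δ / invDiag S k := fun k => div_pos hδ (invDiag_pos hS k)
  have hi : ∀ k : Fin nt, Integrable (fun x : ℝ => (ω x : ℂ) *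
      meijerG r [1, 1] [] [1] [0] (δ / invDiag S k * x)) (volume.restrict (Ioi 0)) := fun k =>
    hP.weight.integrableOn_mul_meijerG hn (hpos k) hr
  simp only [Finset.mul_sum, mul_div_right_comm δ]
  refine ⟨integrable_finsetSum _ fun k _ => hi k, ?_⟩
  rw [integral_finsetSum _ fun k _ => hi k, Finset.mul_sum, zfSumRate, Complex.ofReal_sum]
  refine Finset.sum_congr rfl fun k _ => ?_
  rw [(hP.integrable_and_integral_log_one_add_zfSINR hn hS hδ k).2, ← ofReal_integral_mul_log
    (hpos k) hr]
  push_cast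
  rfl

theorem invDiag_one (k : Fin nt) : invDiag (1 : Matrix (Fin nt) (Fin nt) ℂ) k = 1 := by
  simp [invDiag]

end SumRate

end ZFMimo

/-! ### The main theorem. -/

theorem mainTheorem3 {Ω : Type*} [MeasurableSpace Ω] (μ : Measure Ω) [IsProbabilityMeasure μ]
    (nr nt : ℕ) (hnt : 2 ≤ nt) (hnr : nt ≤ nr)
    (ω : ℝ → ℝ) (P : Ω → Matrix (Fin nr) (Fin nt) ℂ) (hP : IsPolyaEnsemble μ P ω)
    (S : Matrix (Fin nt) (Fin nt) ℂ) (hS : S.PosDef) (δ : ℝ) (hδ : 0 < δ) :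
    -- the explicit polynomials are the biorthonormal ones, so `polyaKernel` is the kernel
    IsBiorthonormal nt (polyaP ω) (polyaQ ω) ∧
    -- the kernel at `x = 0`, wherever `ω` is `n_t - 1` times differentiable, hence a.e.
    (∀ᵐ y : ℝ, 0 < y → DifferentiableAt ℝ (iteratedDeriv (nt - 2) ω) y) ∧
    (∀ y : ℝ, 0 < y → DifferentiableAt ℝ (iteratedDeriv (nt - 2) ω) y →
      polyaKernel nt ω 0 y =
        1 / (((nt - 1).factorial : ℝ) * mellinAt ω 1) * (1 / y) *
          iteratedDeriv (nt - 1) (fun x => x ^ nt * ω x) y) ∧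
    -- the density of the SINR of each stream
    (∀ k : Fin nt,
      (∀ γ : ℝ, 0 < γ →
        0 ≤ invDiag S k / (δ * mellinAt ω 1) * ω (invDiag S k * γ / δ)) ∧
      μ.map (fun w => zfSINR δ (channel (P w) S) k) =
        (volume.restrict (Ioi 0)).withDensity fun γ =>
          ENNReal.ofReal (invDiag S k / (δ * mellinAt ω 1) * ω (invDiag S k * γ / δ))) ∧
    -- the sum rate
    (∀ k : Fin nt,
      Integrable (fun w => Real.log (1 + zfSINR δ (channel (P w) S) k)) μ) ∧
    (∀ r : ℝ, Separates r [1, 1] [1] →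
      IntegrableOn (fun x : ℝ => (ω x : ℂ) *
        ∑ k : Fin nt, meijerG r [1, 1] [] [1] [0] (δ * x / invDiag S k)) (Ioi 0) ∧
      (zfSumRate μ δ (fun w => channel (P w) S) : ℂ) =
        1 / (mellinAt ω 1 : ℂ) * ∫ x in Ioi (0 : ℝ), (ω x : ℂ) *
          ∑ k : Fin nt, meijerG r [1, 1] [] [1] [0] (δ * x / invDiag S k)) ∧
    -- linearity in `n_t` without transmit correlation: the factor of `n_t` involves `ω, δ` only
    (S = 1 → ∀ r : ℝ, Separates r [1, 1] [1] →
      (zfSumRate μ δ (fun w => channel (P w) S) : ℂ) =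
        (nt : ℂ) * (1 / (mellinAt ω 1 : ℂ) * ∫ x in Ioi (0 : ℝ),
          (ω x : ℂ) * meijerG r [1, 1] [] [1] [0] (δ * x))) := by
  refine ⟨hP.weight.isBiorthonormal, hP.weight.ae_differentiableAt,
    fun y hy hd => hP.weight.polyaKernel_zero_eq hnt hy hd,
    fun k => (hP.sinr_law hnt hS hδ k).2,
    fun k => (hP.integrable_and_integral_log_one_add_zfSINR hnt hS hδ k).1,
    fun r hr => hP.integrableOn_and_zfSumRate_eq hnt hS hδ hr, fun h1 r hr => ?_⟩
  rw [(hP.integrableOn_and_zfSumRate_eq hnt hS hδ hr).2]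
  subst h1
  simp only [invDiag_one, div_one, Finset.sum_const, Finset.card_univ, Fintype.card_fin,
    nsmul_eq_mul, mul_left_comm _ (nt : ℂ)]
  rw [integral_const_mul]
  ring
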